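/- Let $m\ge 1$ and $n\ge 0$ be integers and let $R=\mathbb{C}[q,q^{-1},v_1,\dots,v_m]$, where $q,v_1,\dots,v_m$ are indeterminates. Let $H(m,1,n)$ be the cyclotomic Hecke algebra, i.e. the associative unital $R$-algebra generated by $\tau,\sigma_1,\dots,\sigma_{n-1}$ (no generators if $n=0$, only $\tau$ if $n=1$) with the defining relations $$\sigma_i\sigma_{i+1}\sigma_i=\sigma_{i+1}\sigma_i\sigma_{i+1}\ (1\le i\le n-2),\qquad \sigma_i\sigma_j=\sigma_j\sigma_i\ (|i-j|>1),$$ $$\tau\sigma_1\tau\sigma_1=\sigma_1\tau\sigma_1\tau,\qquad \tau\sigma_i=\sigma_i\tau\ (i>1),$$ $$\sigma_i^2=(q-q^{-1})\sigma_i+1\ (1\le i\le n-1),\qquad (\tau-v_1)\cdots(\tau-v_m)=0.$$ Let $G(m,1,n)\subset GL_n(\mathbb{C})$ be the complex reflection group of all monomial $n\times n$ matrices whose nonzero entries are $m$-th roots of unity. Then: (i) $H(m,1,n)$ is a flat deformation of the group algebra $\mathbb{C}G(m,1,n)$: it is a free $R$-module of finite rank $|G(m,1,n)|=n!\,m^n$,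 and its specialization $\mathbb{C}\otimes_R H(m,1,n)$ along the ring homomorphism $R\to\mathbb{C}$ that is the identity on $\mathbb{C}$ and sends $q\mapsto 1$, $v_j\mapsto \zeta^{\,j-1}$ with $\zeta=e^{2\pi i/m}$, is isomorphic to $\mathbb{C}G(m,1,n)$ as a $\mathbb{C}$-algebra. (ii) If $n\ge 1$, the subalgebra $\tilde W$ of $H(m,1,n)$ generated by $\tau,\sigma_1,\dots,\sigma_{n-2}$ (for $n=1$: $\tilde W$ is the image of $R$) is isomorphic to $H(m,1,n-1)$, by an isomorphism of $R$-algebras $H(m,1,n-1)\to\tilde W$ that sends $\tau$ to $\tau$ (if $n\ge 2$) and $\sigma_i$ to $\sigma_i$ for $1\le i\le n-2$. -/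

import Mathlib

open scoped TensorProduct LaurentPolynomial

/-- The generators `τ, σ_1, …, σ_{n-1}` of `H(m,1,n)`. For `n = 0` there are none,
and for `n = 1` there is only `τ`. -/
inductive HeckeGen (n : ℕ) : Type
  | tau (h : 1 ≤ n) : HeckeGen n
  | sigma (i : ℕ) (h₁ : 1 ≤ i) (h₂ : i + 1 ≤ n) : HeckeGen n

namespace CyclotomicHecke

section Presentation

variable {A : Type} [CommRing A] {m : ℕ} (q : Aˣ) (v : Fin m → A) (n : ℕ)

/-- The letter `τ` of the free algebra. -/
def freeTau (h : 1 ≤ n) : FreeAlgebra A (HeckeGen n) :=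
  FreeAlgebra.ι A (HeckeGen.tau h)

/-- The letter `σ_i` of the free algebra, `1 ≤ i ≤ n - 1`. -/
def freeSigma (i : ℕ) (h₁ : 1 ≤ i) (h₂ : i + 1 ≤ n) : FreeAlgebra A (HeckeGen n) :=
  FreeAlgebra.ι A (HeckeGen.sigma i h₁ h₂)

/-- The defining relations of the cyclotomic Hecke algebra over `A` with parameters
`q` and `v_1, …, v_m`. -/
inductive Rel : FreeAlgebra A (HeckeGen n) → FreeAlgebra A (HeckeGen n) → Prop
  /-- `σ_i σ_{i+1} σ_i = σ_{i+1} σ_i σ_{i+1}` -/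
  | braid (i : ℕ) (h₁ : 1 ≤ i) (h₂ : i + 1 ≤ n) (h₃ : 1 ≤ i + 1) (h₄ : i + 1 + 1 ≤ n) :
      Rel
        (freeSigma n i h₁ h₂ * freeSigma n (i + 1) h₃ h₄ * freeSigma n i h₁ h₂)
        (freeSigma n (i + 1) h₃ h₄ * freeSigma n i h₁ h₂ * freeSigma n (i + 1) h₃ h₄)
  /-- `σ_i σ_j = σ_j σ_i` for `|i - j| > 1` -/
  | comm (i j : ℕ) (h₁ : 1 ≤ i) (h₂ : i + 1 ≤ n) (h₃ : 1 ≤ j) (h₄ : j + 1 ≤ n)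
      (hij : i + 1 < j ∨ j + 1 < i) :
      Rel
        (freeSigma n i h₁ h₂ * freeSigma n j h₃ h₄)
        (freeSigma n j h₃ h₄ * freeSigma n i h₁ h₂)
  /-- `τ σ_1 τ σ_1 = σ_1 τ σ_1 τ` -/
  | tau_braid (h : 1 ≤ n) (h₁ : 1 ≤ 1) (h₂ : 1 + 1 ≤ n) :
      Rel
        (freeTau n h * freeSigma n 1 h₁ h₂ * freeTau n h * freeSigma n 1 h₁ h₂)
        (freeSigma n 1 h₁ h₂ * freeTau n h * freeSigma n 1 h₁ h₂ * freeTau n h)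
  /-- `τ σ_i = σ_i τ` for `i > 1` -/
  | tau_comm (h : 1 ≤ n) (i : ℕ) (h₁ : 1 ≤ i) (h₂ : i + 1 ≤ n) (hi : 1 < i) :
      Rel
        (freeTau n h * freeSigma n i h₁ h₂)
        (freeSigma n i h₁ h₂ * freeTau n h)
  /-- `σ_i² = (q - q⁻¹) σ_i + 1` -/
  | quadratic (i : ℕ) (h₁ : 1 ≤ i) (h₂ : i + 1 ≤ n) :
      Rel
        (freeSigma n i h₁ h₂ ^ 2)
        (((q : A) - ((q⁻¹ : Aˣ) : A)) • freeSigma n i h₁ h₂ + 1)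
  /-- `(τ - v_1) ⋯ (τ - v_m) = 0` -/
  | cyclotomic (h : 1 ≤ n) :
      Rel
        (List.ofFn fun j : Fin m => freeTau n h - algebraMap A _ (v j)).prod
        0

end Presentation

end CyclotomicHecke

/-- The cyclotomic Hecke algebra `H(m,1,n)` over a commutative ring `A` with parameters `q`
(invertible) and `v_1, …, v_m`: the associative unital `A`-algebra generated by
`τ, σ_1, …, σ_{n-1}` with the defining relations above. -/
def CyclotomicHecke {A : Type} [CommRing A] {m : ℕ} (q : Aˣ) (v : Fin m → A) (n : ℕ) : Type :=
  RingQuot (CyclotomicHecke.Rel q v n)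

namespace CyclotomicHecke

section Instances

variable {A : Type} [CommRing A] {m : ℕ} (q : Aˣ) (v : Fin m → A) (n : ℕ)

instance : Ring (CyclotomicHecke q v n) :=
  inferInstanceAs (Ring (RingQuot (CyclotomicHecke.Rel q v n)))

instance : Algebra A (CyclotomicHecke q v n) :=
  inferInstanceAs (Algebra A (RingQuot (CyclotomicHecke.Rel q v n)))

/-- The generator `τ`. -/
def tau (h : 1 ≤ n) : CyclotomicHecke q v n :=
  RingQuot.mkAlgHom A (CyclotomicHecke.Rel q v n) (freeTau n h)

/-- The generator `σ_i`, `1 ≤ i ≤ n - 1`. -/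
def sigma (i : ℕ) (h₁ : 1 ≤ i) (h₂ : i + 1 ≤ n) : CyclotomicHecke q v n :=
  RingQuot.mkAlgHom A (CyclotomicHecke.Rel q v n) (freeSigma n i h₁ h₂)

/-- The subalgebra `W̃` generated by the first `n - 1` of the generators
`τ, σ_1, …, σ_{n-1}`: by `τ, σ_1, …, σ_{n-2}` if `n ≥ 2`, and by nothing if `n ≤ 1`. -/
def subW : Subalgebra A (CyclotomicHecke q v n) :=
  Algebra.adjoin A
    {x | (∃ h : 2 ≤ n, x = tau q v n (by omega)) ∨
      ∃ (i : ℕ) (h₁ : 1 ≤ i) (h₂ : i + 2 ≤ n), x = sigma q v n i h₁ (by omega)}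

end Instances

/-! ### The generic algebra -/

/-- The ring `ℂ[q, q⁻¹, v_1, …, v_m]`. -/
abbrev GenericRing (m : ℕ) : Type := MvPolynomial (Fin m) ℂ[T;T⁻¹]

/-- The indeterminate `q`, as a unit of `ℂ[q, q⁻¹, v_1, …, v_m]`. -/
noncomputable def genericQ (m : ℕ) : (GenericRing m)ˣ :=
  Units.map (MvPolynomial.C : ℂ[T;T⁻¹] →+* GenericRing m).toMonoidHom
    ⟨LaurentPolynomial.T 1, LaurentPolynomial.T (-1),
      by rw [← LaurentPolynomial.T_add]; simp,
      by rw [← LaurentPolynomial.T_add]; simp⟩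

/-- The generic algebra `H(m,1,n)` over `ℂ[q, q⁻¹, v_1, …, v_m]`. -/
abbrev Generic (m n : ℕ) : Type :=
  CyclotomicHecke (genericQ m) (MvPolynomial.X : Fin m → GenericRing m) n

/-- The specialization `ℂ[q, q⁻¹, v_1, …, v_m] → ℂ` with `q ↦ 1` and
`v_1, …, v_m ↦ 1, ζ, …, ζ^{m-1}`, where `ζ = exp(2πi/m)`. -/
noncomputable def specialization (m : ℕ) : GenericRing m →+* ℂ :=
  MvPolynomial.eval₂Hom (LaurentPolynomial.eval₂ (RingHom.id ℂ) (1 : ℂˣ))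
    fun j : Fin m => Complex.exp (2 * Real.pi * Complex.I / m) ^ (j : ℕ)

/-- `ℂ` as an algebra over `ℂ[q, q⁻¹, v_1, …, v_m]` through `specialization m`. -/
noncomputable abbrev specializationAlgebra (m : ℕ) : Algebra (GenericRing m) ℂ :=
  (specialization m).toAlgebra

end CyclotomicHecke

/-- The complex reflection group `G(m,1,n)`: the monomial `n × n` matrices whose nonzero entries
are `m`-th roots of unity. -/
def reflectionGroup (m n : ℕ) : Subgroup (GL (Fin n) ℂ) where
  carrier := {g | ∃ (z : Fin n → rootsOfUnity m ℂ) (π : Equiv.Perm (Fin n)),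
    ∀ i j, (g : Matrix (Fin n) (Fin n) ℂ) i j = if i = π j then ((z i : ℂˣ) : ℂ) else 0}
  one_mem' := ⟨1, 1, fun i j => by
    by_cases h : i = j <;> simp [h]⟩
  mul_mem' := by
    rintro g h ⟨z, π, hg⟩ ⟨w, ρ, hh⟩
    refine ⟨fun i => z i * w (π⁻¹ i), π * ρ, fun i j => ?_⟩
    rw [Units.val_mul, Matrix.mul_apply, Finset.sum_eq_single (ρ j)]
    · rw [hg, hh]
      by_cases hi : i = π (ρ j)
      · subst hi; simp
      · simp [hi]
    · intro k _ hk
      simp [hh, hk]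
    · simp
  inv_mem' := by
    rintro g ⟨z, π, hg⟩
    let B : Matrix (Fin n) (Fin n) ℂ := fun i j =>
      if i = π⁻¹ j then (((z (π i))⁻¹ : rootsOfUnity m ℂ) : ℂˣ) else 0
    have hB : (g : Matrix (Fin n) (Fin n) ℂ) * B = 1 := by
      ext i j
      rw [Matrix.mul_apply, Finset.sum_eq_single (π⁻¹ j)]
      · rw [hg]
        by_cases hi : i = j
        · subst hi; simp [B]
        · simp [hi]
      · intro k _ hk
        rw [show B k j = 0 from if_neg hk, mul_zero]
      · simp
    have hinv : ((g⁻¹ : GL (Fin n) ℂ) : Matrix (Fin n) (Fin n) ℂ) = B :=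
      Units.inv_eq_of_mul_eq_one_right hB
    exact ⟨fun i => (z (π i))⁻¹, π⁻¹, fun i j => by rw [hinv]⟩

/-!
The monomials `m_0 m_1 ⋯ m_{n-1}` with `m_k = X_k^a σ_k σ_{k-1} ⋯ σ_{k-j+1}`, where `a < m`,
`j ≤ k` and `X_k = σ_k ⋯ σ_1 τ σ_1 ⋯ σ_k` is a Jucys–Murphy element, span the Hecke algebra: the
left span of the `X_k^a σ_k ⋯ σ_{k-j+1}` over the algebra of level `k` is stable under right
multiplication by the generators. There are `n! m^n` of them.

For independence the algebra acts on the free module on words in `n` distinct coloured letters. The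
`σ_i` act as in the regular representation of the Hecke algebra of type `A`, and `τ` acts as
`σ_1⁻¹ ⋯ σ_{n-1}⁻¹` times a product of operators that deform a transposition only on letters of the
same colour, times the parameter of the colour of the first letter. This `τ` is triangular with
respect to colours, hence satisfies the cyclotomic relation. At `q = 1` with distinct parameters the
sum over all colourings of a word generates the module, so a determinant does not vanish after
specialization, hence does not vanish generically.

The specialization at `q = 1`, `v_j = ζ^(j-1)` maps onto the group algebra of the reflection group,
which has the same dimension. The standard monomials of level `n - 1` are among those of level `n`,
so the inclusion of levels is injective.
-/

namespace CyclotomicHecke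

section Spanning

variable {R H : Type*} [CommRing R] [Ring H] [Algebra R H]

/-- Elements `t` and `s 1, …, s (n - 1)` of an algebra that satisfy the defining relations of the
cyclotomic Hecke algebra, with `c` in the role of `q - q⁻¹`. The other values of `s` are
irrelevant. -/
structure IsHeckeSystem (c : R) {m : ℕ} (v : Fin m → R) (n : ℕ) (t : H) (s : ℕ → H) : Prop where
  braid : ∀ i, 1 ≤ i → i + 2 ≤ n → s i * s (i + 1) * s i = s (i + 1) * s i * s (i + 1)
  comm : ∀ i j, 1 ≤ i → i + 1 < j → j + 1 ≤ n → Commute (s i) (s j)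
  tau_braid : 2 ≤ n → t * s 1 * t * s 1 = s 1 * t * s 1 * t
  tau_comm : ∀ i, 2 ≤ i → i + 1 ≤ n → Commute t (s i)
  quadratic : ∀ i, 1 ≤ i → i + 1 ≤ n → s i * s i = c • s i + 1
  cyclotomic : 1 ≤ n → (List.ofFn fun j : Fin m => t - algebraMap R H (v j)).prod = 0

/-- The Jucys–Murphy element `s_k ⋯ s_1 t s_1 ⋯ s_k`. -/
def jucysMurphy (t : H) (s : ℕ → H) : ℕ → H
  | 0 => t
  | k + 1 => s (k + 1) * jucysMurphy t s k * s (k + 1)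

/-- The product `s_k s_{k-1} ⋯ s_{k-j+1}` of `j` factors. As `j` runs from `0` to `k` these are
the representatives of the cosets of `⟨s_1, …, s_{k-1}⟩` in `⟨s_1, …, s_k⟩`. -/
def descending (s : ℕ → H) (k : ℕ) : ℕ → H
  | 0 => 1
  | j + 1 => descending s k j * s (k - j)

variable (R) in
/-- The subalgebra generated by `t, s_1, …, s_{k-1}`. -/
def parabolic (t : H) (s : ℕ → H) (k : ℕ) : Subalgebra R H :=
  Algebra.adjoin R {x | (1 ≤ k ∧ x = t) ∨ ∃ i, 1 ≤ i ∧ i + 1 ≤ k ∧ x = s i}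

variable (R) in
/-- The span of the elements `w X^a s_k ⋯ s_{k-j+1}` with `w` in the subalgebra generated by
`t, s_1, …, s_{k-1}`, `X` the Jucys–Murphy element of index `k`, and `a < M`. -/
def cosetSpan (t : H) (s : ℕ → H) (k M : ℕ) : Submodule R H :=
  Submodule.span R {x | ∃ w ∈ parabolic R t s k, ∃ a < M, ∃ j ≤ k,
    x = w * jucysMurphy t s k ^ a * descending s k j}

lemma prod_ofFn_sub_algebraMap {m : ℕ} (v : Fin m → R) (t : H) :
    (List.ofFn fun j => t - algebraMap R H (v j)).prod =
      Polynomial.aeval t (∏ j, (Polynomial.X - Polynomial.C (v j))) := by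
  rw [← List.prod_ofFn, map_list_prod, List.map_ofFn]
  congr 2
  ext j
  simp

lemma descending_succ_succ (s : ℕ → H) (k j : ℕ) :
    descending s (k + 1) (j + 1) = s (k + 1) * descending s k j := by
  induction j with
  | zero => simp [descending]
  | succ j ih => rw [descending, ih, mul_assoc, Nat.add_sub_add_right]; rfl

lemma commute_descending {s : ℕ → H} {k j : ℕ} {x : H}
    (hx : ∀ i, k - j < i → i ≤ k → Commute x (s i)) (hj : j ≤ k) :
    Commute x (descending s k j) := by
  induction j with
  | zero => exact Commute.one_right _
  | succ j ih =>
    exact (ih (fun i h₁ h₂ => hx i (by omega) h₂) (by omega)).mul_right (hx _ (by omega) (by omega))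

variable {t : H} {s : ℕ → H}

lemma t_mem_parabolic {k : ℕ} (hk : 1 ≤ k) : t ∈ parabolic R t s k :=
  Algebra.subset_adjoin (Or.inl ⟨hk, rfl⟩)

lemma s_mem_parabolic {k i : ℕ} (hi : 1 ≤ i) (hk : i + 1 ≤ k) : s i ∈ parabolic R t s k :=
  Algebra.subset_adjoin (Or.inr ⟨i, hi, hk, rfl⟩)

variable (R t s) in
lemma parabolic_mono {k l : ℕ} (h : k ≤ l) : parabolic R t s k ≤ parabolic R t s l := by
  apply Algebra.adjoin_mono
  rintro x (⟨hk, rfl⟩ | ⟨i, hi, hik, rfl⟩)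
  · exact Or.inl ⟨hk.trans h, rfl⟩
  · exact Or.inr ⟨i, hi, hik.trans h, rfl⟩

variable (R t s) in
lemma parabolic_zero : parabolic R t s 0 = ⊥ := by
  rw [← Algebra.adjoin_empty R H, parabolic]
  congr 1
  ext x
  simp

lemma commute_of_mem_parabolic {k : ℕ} {x w : H} (hw : w ∈ parabolic R t s k)
    (ht : 1 ≤ k → Commute x t) (hs : ∀ i, 1 ≤ i → i + 1 ≤ k → Commute x (s i)) : Commute x w := by
  refine Algebra.commute_of_mem_adjoin_of_forall_mem_commute hw ?_
  rintro y (⟨hk, rfl⟩ | ⟨i, hi, hik, rfl⟩)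
  · exact ht hk
  · exact hs i hi hik

lemma mul_mem_of_mem_parabolic {k : ℕ} {N : Submodule R H}
    (ht : 1 ≤ k → ∀ x ∈ N, x * t ∈ N)
    (hs : ∀ i, 1 ≤ i → i + 1 ≤ k → ∀ x ∈ N, x * s i ∈ N) {x w : H} (hx : x ∈ N)
    (hw : w ∈ parabolic R t s k) : x * w ∈ N := by
  induction hw using Algebra.adjoin_induction generalizing x with
  | mem y hy =>
    rcases hy with ⟨hk, rfl⟩ | ⟨i, hi, hik, rfl⟩
    · exact ht hk x hx
    · exact hs i hi hik x hx
  | algebraMap r =>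
    rw [← Algebra.commutes, ← Algebra.smul_def]
    exact N.smul_mem r hx
  | add y z _ _ hy hz => rw [mul_add]; exact add_mem (hy hx) (hz hx)
  | mul y z _ _ hy hz => rw [← mul_assoc]; exact hz (hy hx)

variable (R t s) in
lemma jucysMurphy_mem_parabolic (k : ℕ) : jucysMurphy t s k ∈ parabolic R t s (k + 1) := by
  induction k with
  | zero => exact t_mem_parabolic le_rfl
  | succ k ih =>
    have hs : s (k + 1) ∈ parabolic R t s (k + 2) := s_mem_parabolic (by omega) (by omega)
    exact mul_mem (mul_mem hs (parabolic_mono R t s (Nat.le_succ (k + 1)) ih)) hs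

lemma cosetSpan_le {k M : ℕ} {N : Submodule R H}
    (hN : ∀ w ∈ parabolic R t s k, ∀ a < M, ∀ j ≤ k,
      w * jucysMurphy t s k ^ a * descending s k j ∈ N) : cosetSpan R t s k M ≤ N := by
  refine Submodule.span_le.2 ?_
  rintro _ ⟨w, hw, a, ha, j, hj, rfl⟩
  exact hN w hw a ha j hj

lemma mul_mul_descending_mem_cosetSpan {k M a j : ℕ} {w : H} (hw : w ∈ parabolic R t s k)
    (ha : a < M) (hj : j ≤ k) :
    w * jucysMurphy t s k ^ a * descending s k j ∈ cosetSpan R t s k M :=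
  Submodule.subset_span ⟨w, hw, a, ha, j, hj, rfl⟩

lemma mul_jucysMurphy_pow_mem_cosetSpan {k M a : ℕ} {w : H} (hw : w ∈ parabolic R t s k)
    (ha : a < M) : w * jucysMurphy t s k ^ a ∈ cosetSpan R t s k M := by
  simpa [descending] using mul_mul_descending_mem_cosetSpan hw ha k.zero_le

variable (R t s) in
lemma jucysMurphy_pow_mem_cosetSpan_of_lt {k M a : ℕ} (ha : a < M) :
    jucysMurphy t s k ^ a ∈ cosetSpan R t s k M := by
  simpa using mul_jucysMurphy_pow_mem_cosetSpan (one_mem (parabolic R t s k)) ha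

lemma mul_mem_cosetSpan {k M : ℕ} {w x : H} (hw : w ∈ parabolic R t s k)
    (hx : x ∈ cosetSpan R t s k M) : w * x ∈ cosetSpan R t s k M := by
  suffices cosetSpan R t s k M ≤ (cosetSpan R t s k M).comap (LinearMap.mulLeft R w) from this hx
  refine cosetSpan_le fun w' hw' a ha j hj => ?_
  rw [Submodule.mem_comap, LinearMap.mulLeft_apply, ← mul_assoc, ← mul_assoc]
  exact mul_mul_descending_mem_cosetSpan (mul_mem hw hw') ha hj

lemma mul_pow_eq_pow_mul_sub_sum {c : R} {x y σ : H} (hyx : Commute y x)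
    (hσ : σ * x = y * σ - c • y) (a : ℕ) :
    σ * x ^ a = y ^ a * σ - c • ∑ i ∈ Finset.range a, x ^ i * y ^ (a - i) := by
  induction a with
  | zero => simp
  | succ a ih =>
    have hsum : (∑ i ∈ Finset.range a, x ^ i * y ^ (a - i)) * x =
        ∑ i ∈ Finset.range a, x ^ (i + 1) * y ^ (a + 1 - (i + 1)) := by
      rw [Finset.sum_mul]
      refine Finset.sum_congr rfl fun i _ => ?_
      rw [mul_assoc, (hyx.pow_left _).eq, ← mul_assoc, ← pow_succ, Nat.add_sub_add_right]
    calc σ * x ^ (a + 1)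
        = y ^ a * (σ * x) - c • ((∑ i ∈ Finset.range a, x ^ i * y ^ (a - i)) * x) := by
          rw [pow_succ, ← mul_assoc, ih, sub_mul, smul_mul_assoc, mul_assoc]
      _ = y ^ (a + 1) * σ -
            c • (∑ i ∈ Finset.range a, x ^ (i + 1) * y ^ (a + 1 - (i + 1)) + y ^ (a + 1)) := by
          rw [hσ, hsum, mul_sub, ← mul_assoc, mul_smul_comm, ← pow_succ, smul_add]
          abel
      _ = _ := by simp [Finset.sum_range_succ' _ a]

namespace IsHeckeSystem

variable {c : R} {m : ℕ} {v : Fin m → R} {n : ℕ}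

lemma commute_s (h : IsHeckeSystem c v n t s) {i j : ℕ} (hi : 1 ≤ i) (hin : i + 1 ≤ n)
    (hj : 1 ≤ j) (hjn : j + 1 ≤ n) (hij : i + 1 < j ∨ j + 1 < i) : Commute (s i) (s j) :=
  hij.elim (fun hij => h.comm i j hi hij hjn) fun hij => (h.comm j i hj hij hin).symm

lemma commute_jucysMurphy_s_of_lt (h : IsHeckeSystem c v n t s) {k i : ℕ} (hki : k + 2 ≤ i)
    (hin : i + 1 ≤ n) : Commute (jucysMurphy t s k) (s i) := by
  induction k with
  | zero => exact h.tau_comm i hki hin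
  | succ k ih =>
    have hc : Commute (s (k + 1)) (s i) := h.comm _ _ (by omega) (by omega) hin
    exact (hc.mul_left (ih (by omega))).mul_left hc

lemma commute_jucysMurphy_s (h : IsHeckeSystem c v n t s) {k i : ℕ} (hi : 1 ≤ i)
    (hik : i + 1 ≤ k) (hkn : k + 1 ≤ n) : Commute (jucysMurphy t s k) (s i) := by
  induction k with
  | zero => omega
  | succ k ih =>
    rcases Nat.lt_or_ge i k with hik' | hik'
    · have hc : Commute (s (k + 1)) (s i) := (h.comm _ _ hi (by omega) hkn).symm
      exact (hc.mul_left (ih (by omega) (by omega))).mul_left hc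
    · obtain ⟨i, rfl⟩ : ∃ j, i = j + 1 := ⟨i - 1, by omega⟩
      obtain rfl : k = i + 1 := by omega
      have hb := h.braid (i + 1) (by omega) (by omega)
      have hX : jucysMurphy t s i * s (i + 1 + 1) = s (i + 1 + 1) * jucysMurphy t s i :=
        h.commute_jucysMurphy_s_of_lt (by omega) (by omega)
      rw [commute_iff_eq]
      simp only [jucysMurphy]
      generalize s (i + 1) = a, s (i + 1 + 1) = b, jucysMurphy t s i = x at hb hX ⊢
      calc b * (a * x * a) * b * a = b * a * x * (a * b * a) := by simp only [mul_assoc]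
        _ = b * a * (x * b) * a * b := by rw [hb]; simp only [mul_assoc]
        _ = (b * a * b) * x * a * b := by rw [hX]; simp only [mul_assoc]
        _ = a * (b * (a * x * a) * b) := by rw [← hb]; simp only [mul_assoc]

lemma commute_jucysMurphy_t (h : IsHeckeSystem c v n t s) {k : ℕ} (hkn : k + 1 ≤ n) :
    Commute (jucysMurphy t s k) t := by
  induction k with
  | zero => exact Commute.refl t
  | succ k ih =>
    rcases k.eq_zero_or_pos with rfl | hk
    · simpa [commute_iff_eq, jucysMurphy, mul_assoc] using (h.tau_braid hkn).symm
    · have hc : Commute (s (k + 1)) t := (h.tau_comm _ (by omega) hkn).symm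
      exact (hc.mul_left (ih (by omega))).mul_left hc

lemma commute_jucysMurphy (h : IsHeckeSystem c v n t s) {k : ℕ} (hkn : k + 1 ≤ n) {w : H}
    (hw : w ∈ parabolic R t s k) : Commute (jucysMurphy t s k) w :=
  commute_of_mem_parabolic hw (fun _ => h.commute_jucysMurphy_t hkn)
    fun _ hi hik => h.commute_jucysMurphy_s hi hik hkn

lemma commute_s_of_mem_parabolic (h : IsHeckeSystem c v n t s) {k : ℕ} (hkn : k + 2 ≤ n) {w : H}
    (hw : w ∈ parabolic R t s k) : Commute (s (k + 1)) w :=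
  commute_of_mem_parabolic hw (fun _ => (h.tau_comm _ (by omega) (by omega)).symm)
    fun _ hi _ => (h.comm _ _ hi (by omega) (by omega)).symm

lemma commute_s_descending (h : IsHeckeSystem c v n t s) {k j i : ℕ} (hkn : k + 1 ≤ n)
    (hi : 1 ≤ i) (hij : i + j < k) : Commute (s i) (descending s k j) :=
  commute_descending (fun _ _ _ => h.comm _ _ hi (by omega) (by omega)) (by omega)

lemma descending_succ_mul_s (h : IsHeckeSystem c v n t s) {k j : ℕ} (hkn : k + 1 ≤ n)
    (hj : j + 1 ≤ k) :
    descending s k (j + 1) * s (k - j) = c • descending s k (j + 1) + descending s k j := by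
  rw [descending, mul_assoc, h.quadratic _ (by omega) (by omega), mul_add, mul_one, mul_smul_comm]

lemma descending_mul_s_succ (h : IsHeckeSystem c v n t s) {k j i : ℕ} (hkn : k + 1 ≤ n)
    (hj : j ≤ k) (hij : k < i + j) (hik : i + 1 ≤ k) :
    descending s k j * s (i + 1) = s i * descending s k j := by
  induction j with
  | zero => omega
  | succ j ih =>
    rcases Nat.lt_or_ge k (i + j) with hlt | hge
    · have hc : s (k - j) * s (i + 1) = s (i + 1) * s (k - j) :=
        h.comm _ _ (by omega) (by omega) (by omega)
      rw [descending, mul_assoc, hc, ← mul_assoc, ih (by omega) hlt, mul_assoc]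
    · obtain ⟨j, rfl⟩ : ∃ l, j = l + 1 := ⟨j - 1, by omega⟩
      have hb := h.braid i (by omega) (by omega)
      have hc : s i * descending s k j = descending s k j * s i :=
        h.commute_s_descending hkn (by omega) (by omega)
      rw [descending, descending, show k - (j + 1) = i by omega, show k - j = i + 1 by omega]
      calc descending s k j * s (i + 1) * s i * s (i + 1)
          = descending s k j * (s (i + 1) * s i * s (i + 1)) := by simp only [mul_assoc]
        _ = descending s k j * s i * s (i + 1) * s i := by rw [← hb]; simp only [mul_assoc]
        _ = s i * (descending s k j * s (i + 1) * s i) := by rw [← hc]; simp only [mul_assoc]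

lemma mul_mul_descending_mul_mem_cosetSpan (h : IsHeckeSystem c v n t s) {k M a j : ℕ}
    {w x y : H} (hkn : k + 1 ≤ n) (hw : w ∈ parabolic R t s k) (ha : a < M) (hj : j ≤ k)
    (hx : x ∈ parabolic R t s k) (hxy : descending s k j * y = x * descending s k j) :
    w * jucysMurphy t s k ^ a * descending s k j * y ∈ cosetSpan R t s k M := by
  have hX : jucysMurphy t s k ^ a * x = x * jucysMurphy t s k ^ a :=
    (h.commute_jucysMurphy hkn hx).pow_left a
  rw [mul_assoc, hxy, ← mul_assoc, mul_assoc w, hX, ← mul_assoc]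
  exact mul_mul_descending_mem_cosetSpan (mul_mem hw hx) ha hj

lemma mul_s_mem_cosetSpan (h : IsHeckeSystem c v n t s) {k M i : ℕ} (hkn : k + 1 ≤ n)
    (hi : 1 ≤ i) (hik : i ≤ k) {x : H} (hx : x ∈ cosetSpan R t s k M) :
    x * s i ∈ cosetSpan R t s k M := by
  suffices cosetSpan R t s k M ≤ (cosetSpan R t s k M).comap (LinearMap.mulRight R (s i)) from
    this hx
  refine cosetSpan_le fun w hw a ha j hj => ?_
  rw [Submodule.mem_comap, LinearMap.mulRight_apply]
  rcases lt_trichotomy (i + j) k with hlt | heq | hgt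
  · exact h.mul_mul_descending_mul_mem_cosetSpan hkn hw ha hj (s_mem_parabolic hi (by omega))
      (h.commute_s_descending hkn hi hlt).eq.symm
  · obtain rfl : i = k - j := by omega
    rw [mul_assoc]
    exact mul_mul_descending_mem_cosetSpan (j := j + 1) hw ha (by omega)
  · rcases (show k + 1 ≤ i + j from hgt).eq_or_lt with heq | hlt
    · obtain ⟨j, rfl⟩ : ∃ l, j = l + 1 := ⟨j - 1, by omega⟩
      obtain rfl : i = k - j := by omega
      rw [mul_assoc, h.descending_succ_mul_s hkn hj, mul_add, mul_smul_comm]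
      exact add_mem (Submodule.smul_mem _ _ (mul_mul_descending_mem_cosetSpan hw ha hj))
        (mul_mul_descending_mem_cosetSpan hw ha (by omega))
    · obtain ⟨i, rfl⟩ : ∃ l, i = l + 1 := ⟨i - 1, by omega⟩
      exact h.mul_mul_descending_mul_mem_cosetSpan hkn hw ha hj
        (s_mem_parabolic (by omega) (by omega))
        (h.descending_mul_s_succ hkn hj (by omega) hik)

lemma mul_descending_mem_cosetSpan (h : IsHeckeSystem c v n t s) {k M l j : ℕ} (hkn : k + 1 ≤ n)
    (hl : l ≤ k) (hj : j ≤ l) {x : H} (hx : x ∈ cosetSpan R t s k M) :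
    x * descending s l j ∈ cosetSpan R t s k M := by
  induction j with
  | zero => simpa [descending] using hx
  | succ j ih =>
    rw [descending, ← mul_assoc]
    exact h.mul_s_mem_cosetSpan hkn (by omega) (by omega) (ih (by omega))

lemma s_mul_jucysMurphy (h : IsHeckeSystem c v n t s) {k : ℕ} (hkn : k + 2 ≤ n) :
    s (k + 1) * jucysMurphy t s k =
      jucysMurphy t s (k + 1) * s (k + 1) - c • jucysMurphy t s (k + 1) := by
  rw [jucysMurphy, mul_assoc _ (s (k + 1)) (s (k + 1)), h.quadratic _ (by omega) (by omega),
    mul_add, mul_smul_comm, mul_one, add_sub_cancel_left]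

lemma s_mul_jucysMurphy_pow (h : IsHeckeSystem c v n t s) {k : ℕ} (hkn : k + 2 ≤ n) (a : ℕ) :
    s (k + 1) * jucysMurphy t s k ^ a = jucysMurphy t s (k + 1) ^ a * s (k + 1) -
      c • ∑ i ∈ Finset.range a, jucysMurphy t s k ^ i * jucysMurphy t s (k + 1) ^ (a - i) :=
  mul_pow_eq_pow_mul_sub_sum
    (h.commute_jucysMurphy (by omega) (jucysMurphy_mem_parabolic R t s k))
    (h.s_mul_jucysMurphy hkn) a

lemma jucysMurphy_succ_pow (h : IsHeckeSystem c v n t s) {k : ℕ} (hkn : k + 2 ≤ n) (a : ℕ) :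
    jucysMurphy t s (k + 1) ^ (a + 1) = s (k + 1) * jucysMurphy t s k ^ (a + 1) * s (k + 1) +
      c • ∑ i ∈ Finset.range a, jucysMurphy t s k ^ (i + 1) *
        jucysMurphy t s (k + 1) ^ (a - i) * s (k + 1) := by
  rw [h.s_mul_jucysMurphy_pow hkn, sub_mul, mul_assoc, h.quadratic (k + 1) (by omega) (by omega),
    Finset.sum_range_succ']
  simp only [mul_add, mul_smul_comm, mul_one, smul_mul_assoc, add_mul, Finset.sum_mul, smul_add,
    pow_zero, one_mul, Nat.sub_zero, Nat.add_sub_add_right]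
  abel

lemma s_mul_jucysMurphy_pow_mem_cosetSpan (h : IsHeckeSystem c v n t s) {k M a : ℕ}
    (hkn : k + 2 ≤ n) (ha : a < M) :
    s (k + 1) * jucysMurphy t s k ^ a ∈ cosetSpan R t s (k + 1) M := by
  rw [h.s_mul_jucysMurphy_pow hkn]
  refine sub_mem ?_ (Submodule.smul_mem _ _ (Submodule.sum_mem _ fun i _ => ?_))
  · exact h.mul_s_mem_cosetSpan hkn (by omega) le_rfl
      (jucysMurphy_pow_mem_cosetSpan_of_lt R t s ha)
  · exact mul_jucysMurphy_pow_mem_cosetSpan (pow_mem (jucysMurphy_mem_parabolic R t s k) i)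
      (by omega)

lemma s_mul_mul_s_mem_cosetSpan (h : IsHeckeSystem c v n t s) {k M : ℕ} (hkn : k + 2 ≤ n) {x : H}
    (hx : x ∈ cosetSpan R t s k M) : s (k + 1) * x * s (k + 1) ∈ cosetSpan R t s (k + 1) M := by
  refine h.mul_s_mem_cosetSpan hkn (by omega) le_rfl ?_
  suffices cosetSpan R t s k M ≤
    (cosetSpan R t s (k + 1) M).comap (LinearMap.mulLeft R (s (k + 1))) from this hx
  refine cosetSpan_le fun w hw a ha j hj => ?_
  rw [Submodule.mem_comap, LinearMap.mulLeft_apply, mul_assoc w, ← mul_assoc,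
    (h.commute_s_of_mem_parabolic hkn hw).eq, mul_assoc, ← mul_assoc (s (k + 1))]
  exact mul_mem_cosetSpan (parabolic_mono R t s k.le_succ hw) <|
    h.mul_descending_mem_cosetSpan hkn k.le_succ hj (h.s_mul_jucysMurphy_pow_mem_cosetSpan hkn ha)

lemma t_pow_mem_span (h : IsHeckeSystem c v n t s) (hn : 1 ≤ n) :
    t ^ m ∈ Submodule.span R ((t ^ ·) '' (Finset.range m : Set ℕ)) := by
  classical
  nontriviality H
  have := (algebraMap R H).domain_nontrivial
  have hroot : Polynomial.aeval t (∏ j, (Polynomial.X - Polynomial.C (v j))) = 0 := by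
    rw [← prod_ofFn_sub_algebraMap, h.cyclotomic hn]
  have hspan := Submodule.span_range_natDegree_eq_adjoin
    (Polynomial.monic_prod_X_sub_C v Finset.univ) hroot
  rw [Polynomial.natDegree_finsetProd_X_sub_C_eq_card, Finset.card_fin, Finset.coe_image] at hspan
  rw [hspan]
  exact pow_mem (Algebra.self_mem_adjoin_singleton R t) m

lemma jucysMurphy_pow_mem_cosetSpan (h : IsHeckeSystem c v n t s) (hm : 1 ≤ m) {k : ℕ}
    (hkn : k + 1 ≤ n) : jucysMurphy t s k ^ m ∈ cosetSpan R t s k m := by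
  induction k with
  | zero =>
    refine Submodule.span_le.2 ?_ (h.t_pow_mem_span hkn)
    rintro _ ⟨a, ha, rfl⟩
    exact jucysMurphy_pow_mem_cosetSpan_of_lt R t s (Finset.mem_range.1 ha)
  | succ k ih =>
    obtain ⟨m, rfl⟩ : ∃ l, m = l + 1 := ⟨m - 1, by omega⟩
    rw [h.jucysMurphy_succ_pow hkn]
    refine add_mem (h.s_mul_mul_s_mem_cosetSpan hkn (ih (by omega)))
      (Submodule.smul_mem _ _ (Submodule.sum_mem _ fun i _ => ?_))
    exact h.mul_s_mem_cosetSpan hkn (by omega) le_rfl (mul_jucysMurphy_pow_mem_cosetSpan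
      (pow_mem (jucysMurphy_mem_parabolic R t s k) _) (by omega))

lemma mul_descending_mul_t_mem_cosetSpan (h : IsHeckeSystem c v n t s) {k l M : ℕ}
    (hkn : k + 1 ≤ n) (hl : l ≤ k) {x : H} (hx : x * jucysMurphy t s l ∈ cosetSpan R t s k M) :
    x * descending s l l * t ∈ cosetSpan R t s k M := by
  induction l generalizing x with
  | zero => simpa [descending, jucysMurphy] using hx
  | succ l ih =>
    rw [descending_succ_succ, ← mul_assoc]
    refine ih (by omega) ?_
    rw [mul_assoc, h.s_mul_jucysMurphy (by omega), mul_sub, mul_smul_comm, ← mul_assoc]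
    exact sub_mem (h.mul_s_mem_cosetSpan hkn (by omega) hl hx) (Submodule.smul_mem _ _ hx)

lemma mul_t_mem_cosetSpan (h : IsHeckeSystem c v n t s) (hm : 1 ≤ m) {k : ℕ} (hkn : k + 1 ≤ n)
    {x : H} (hx : x ∈ cosetSpan R t s k m) : x * t ∈ cosetSpan R t s k m := by
  suffices cosetSpan R t s k m ≤ (cosetSpan R t s k m).comap (LinearMap.mulRight R t) from this hx
  refine cosetSpan_le fun w hw a ha j hj => ?_
  rw [Submodule.mem_comap, LinearMap.mulRight_apply]
  rcases hj.lt_or_eq with hjk | rfl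
  · have hd : Commute t (descending s k j) :=
      commute_descending (fun i _ _ => h.tau_comm _ (by omega) (by omega)) hj
    exact h.mul_mul_descending_mul_mem_cosetSpan hkn hw ha hj (t_mem_parabolic (by omega))
      hd.eq.symm
  · refine h.mul_descending_mul_t_mem_cosetSpan hkn le_rfl ?_
    rw [mul_assoc, ← pow_succ]
    refine mul_mem_cosetSpan hw ?_
    rcases (show a + 1 ≤ m from ha).lt_or_eq with hlt | rfl
    · exact jucysMurphy_pow_mem_cosetSpan_of_lt R t s hlt
    · exact h.jucysMurphy_pow_mem_cosetSpan hm hkn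

lemma parabolic_le_cosetSpan (h : IsHeckeSystem c v n t s) (hm : 1 ≤ m) {k : ℕ}
    (hkn : k + 1 ≤ n) : (parabolic R t s (k + 1)).toSubmodule ≤ cosetSpan R t s k m := by
  intro w hw
  have hone : (1 : H) ∈ cosetSpan R t s k m := by
    simpa using jucysMurphy_pow_mem_cosetSpan_of_lt R t s (k := k) (a := 0) hm
  simpa using mul_mem_of_mem_parabolic (fun _ _ => h.mul_t_mem_cosetSpan hm hkn)
    (fun _ hi hik _ => h.mul_s_mem_cosetSpan hkn hi (by omega)) hone hw

end IsHeckeSystem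

/-- The index set of the standard monomials: a power `a < m` and a coset representative `j ≤ k`
for every level `k < n`. -/
def MonomialIndex (m : ℕ) : ℕ → Type
  | 0 => Unit
  | k + 1 => MonomialIndex m k × (Fin m × Fin (k + 1))

instance MonomialIndex.fintype (m : ℕ) : ∀ k, Fintype (MonomialIndex m k)
  | 0 => inferInstanceAs (Fintype Unit)
  | k + 1 =>
    letI := MonomialIndex.fintype m k
    inferInstanceAs (Fintype (MonomialIndex m k × (Fin m × Fin (k + 1))))

lemma card_monomialIndex (m n : ℕ) :
    Fintype.card (MonomialIndex m n) = n.factorial * m ^ n := by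
  induction n with
  | zero => exact Fintype.card_unit
  | succ k ih =>
    calc Fintype.card (MonomialIndex m (k + 1))
        = Fintype.card (MonomialIndex m k) * Fintype.card (Fin m × Fin (k + 1)) :=
          Fintype.card_prod _ _
      _ = (k + 1).factorial * m ^ (k + 1) := by
          rw [ih, Fintype.card_prod, Fintype.card_fin, Fintype.card_fin, Nat.factorial_succ]
          ring

/-- The standard monomials of Ariki and Koike: products over the levels `k = 0, 1, …` of the
elements `X^a s_k ⋯ s_{k-j+1}`, with `X` the Jucys–Murphy element of index `k`. -/
def standardMonomial (t : H) (s : ℕ → H) (m : ℕ) : ∀ k, MonomialIndex m k → H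
  | 0, _ => 1
  | k + 1, (i, a, j) =>
    standardMonomial t s m k i * jucysMurphy t s k ^ (a : ℕ) * descending s k j

theorem IsHeckeSystem.parabolic_le_span_standardMonomial {c : R} {m : ℕ} {v : Fin m → R} {n : ℕ}
    (h : IsHeckeSystem c v n t s) (hm : 1 ≤ m) {k : ℕ} (hkn : k ≤ n) :
    (parabolic R t s k).toSubmodule ≤
      Submodule.span R (Set.range (standardMonomial t s m k)) := by
  induction k with
  | zero =>
    rw [parabolic_zero, Algebra.toSubmodule_bot, Submodule.one_eq_span]
    exact Submodule.span_mono (Set.singleton_subset_iff.2 ⟨(), rfl⟩)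
  | succ k ih =>
    refine (h.parabolic_le_cosetSpan hm hkn).trans (cosetSpan_le fun w hw a ha j hj => ?_)
    suffices Submodule.span R (Set.range (standardMonomial t s m k)) ≤
        (Submodule.span R (Set.range (standardMonomial t s m (k + 1)))).comap
          (LinearMap.mulRight R (jucysMurphy t s k ^ a * descending s k j)) by
      simpa [mul_assoc] using this (ih (by omega) hw)
    refine Submodule.span_le.2 ?_
    rintro _ ⟨i, rfl⟩
    exact Submodule.subset_span
      ⟨(i, ⟨a, ha⟩, ⟨j, Nat.lt_succ_of_le hj⟩), mul_assoc _ _ _⟩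

end Spanning

section Naturality

variable {H K : Type*} [Ring H] [Ring K] {f : H →+* K} {t : H} {s : ℕ → H} {t' : K} {s' : ℕ → K}

lemma map_jucysMurphy (ht : f t = t') {k : ℕ} (hs : ∀ i, 1 ≤ i → i ≤ k → f (s i) = s' i) :
    f (jucysMurphy t s k) = jucysMurphy t' s' k := by
  induction k with
  | zero => exact ht
  | succ k ih =>
    rw [jucysMurphy, map_mul, map_mul, ih fun i hi hik => hs i hi (by omega),
      hs _ (by omega) le_rfl, jucysMurphy]

lemma map_descending {k j : ℕ} (hs : ∀ i, 1 ≤ i → i ≤ k → f (s i) = s' i) (hj : j ≤ k) :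
    f (descending s k j) = descending s' k j := by
  induction j with
  | zero => exact map_one f
  | succ j ih =>
    rw [descending, map_mul, ih (by omega), hs _ (by omega) (by omega), descending]

lemma map_standardMonomial {m k : ℕ} (ht : 1 ≤ k → f t = t')
    (hs : ∀ i, 1 ≤ i → i + 1 ≤ k → f (s i) = s' i) (i : MonomialIndex m k) :
    f (standardMonomial t s m k i) = standardMonomial t' s' m k i := by
  induction k with
  | zero => exact map_one f
  | succ k ih =>
    obtain ⟨i, a, j⟩ := i
    have hs' : ∀ i, 1 ≤ i → i ≤ k → f (s i) = s' i := fun i hi hik => hs i hi (by omega)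
    simp only [standardMonomial, map_mul, map_pow]
    rw [ih (fun _ => ht (by omega)) (fun i hi hik => hs i hi (by omega)),
      map_jucysMurphy (ht (by omega)) hs', map_descending hs' (by omega)]

end Naturality

/-! ### Operators on words -/

/-- Infinite words with pairwise distinct letters in `L`. They carry the representations below, in
which the algebra of rank `n` acts on the letters at the positions `1, …, n`; an infinite word has
a letter at position `i + 1` for every `i`, so that no rank has to be recorded. -/
@[ext]
structure Word (L : Type*) where
  /-- The letter at a given position. -/
  letter : ℕ → L
  injective : Function.Injective letter

namespace Word

variable {L : Type*} (x : Word L)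

/-- The word with the letters at the positions `i` and `i + 1` exchanged. -/
def exchange (i : ℕ) : Word L :=
  ⟨x.letter ∘ Equiv.swap i (i + 1), x.injective.comp (Equiv.injective _)⟩

lemma letter_exchange (i p : ℕ) :
    (x.exchange i).letter p =
      if p = i then x.letter (i + 1) else if p = i + 1 then x.letter i else x.letter p := by
  simp only [exchange, Function.comp, Equiv.swap_apply_def]
  split_ifs <;> rfl

@[simp] lemma letter_exchange_left (i : ℕ) : (x.exchange i).letter i = x.letter (i + 1) := by
  simp [letter_exchange]

@[simp] lemma letter_exchange_right (i : ℕ) : (x.exchange i).letter (i + 1) = x.letter i := by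
  simp [letter_exchange]

lemma letter_exchange_of_ne {i p : ℕ} (h₁ : p ≠ i) (h₂ : p ≠ i + 1) :
    (x.exchange i).letter p = x.letter p := by
  simp [letter_exchange, h₁, h₂]

@[simp] lemma exchange_exchange (i : ℕ) : (x.exchange i).exchange i = x := by
  ext p; simp only [letter_exchange]; grind

lemma exchange_comm {i j : ℕ} (h : i + 1 < j) :
    (x.exchange i).exchange j = (x.exchange j).exchange i := by
  ext p; simp only [letter_exchange]; grind

lemma exchange_braid (i : ℕ) :
    ((x.exchange i).exchange (i + 1)).exchange i =
      ((x.exchange (i + 1)).exchange i).exchange (i + 1) := by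
  ext p; simp only [letter_exchange]; grind

end Word

section ExchangeOperators

variable {R : Type*} [CommRing R] {L : Type*}

/-- The basis vector of a word in the free module on all words. -/
noncomputable def wordVec (R : Type*) [CommRing R] {L : Type*} (x : Word L) : Word L →₀ R :=
  Finsupp.single x 1

/-- The operator that sends a word with the letters `a`, `b` at the positions `i`, `i + 1` to the
word with these letters exchanged, plus `f a b` times the original word. -/
noncomputable def exchangeOp (f : L → L → R) (i : ℕ) : Module.End R (Word L →₀ R) :=
  Finsupp.lsum R fun x => LinearMap.toSpanSingleton R _
    (wordVec R (x.exchange i) + f (x.letter i) (x.letter (i + 1)) • wordVec R x)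

/-- The diagonal operator that multiplies a word by a function of its letter at position `p`. -/
noncomputable def letterOp (g : L → R) (p : ℕ) : Module.End R (Word L →₀ R) :=
  Finsupp.lsum R fun x => LinearMap.toSpanSingleton R _ (g (x.letter p) • wordVec R x)

@[simp] lemma exchangeOp_wordVec (f : L → L → R) (i : ℕ) (x : Word L) :
    exchangeOp f i (wordVec R x) =
      wordVec R (x.exchange i) + f (x.letter i) (x.letter (i + 1)) • wordVec R x := by
  simp [exchangeOp, wordVec]

@[simp] lemma letterOp_wordVec (g : L → R) (p : ℕ) (x : Word L) :
    letterOp g p (wordVec R x) = g (x.letter p) • wordVec R x := by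
  simp [letterOp, wordVec]

lemma wordVec_hom_ext {N : Type*} [AddCommMonoid N] [Module R N] {A B : (Word L →₀ R) →ₗ[R] N}
    (h : ∀ x, A (wordVec R x) = B (wordVec R x)) : A = B :=
  Finsupp.lhom_ext' fun x => LinearMap.ext_ring (h x)

lemma commute_exchangeOp_of_lt (f g : L → L → R) {i j : ℕ} (h : i + 1 < j) :
    Commute (exchangeOp f i) (exchangeOp g j) := by
  refine wordVec_hom_ext fun x => ?_
  simp only [Module.End.mul_apply, exchangeOp_wordVec, map_add, map_smul]
  rw [x.letter_exchange_of_ne (i := i) (p := j) (by omega) (by omega),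
    x.letter_exchange_of_ne (i := i) (p := j + 1) (by omega) (by omega),
    x.letter_exchange_of_ne (i := j) (p := i) (by omega) (by omega),
    x.letter_exchange_of_ne (i := j) (p := i + 1) (by omega) (by omega), x.exchange_comm h]
  module

lemma commute_exchangeOp {f g : L → L → R} {i j : ℕ} (h : i + 1 < j ∨ j + 1 < i) :
    Commute (exchangeOp f i) (exchangeOp g j) :=
  h.elim (commute_exchangeOp_of_lt f g) fun h => (commute_exchangeOp_of_lt g f h).symm

lemma exchangeOp_zero_mul_self (i : ℕ) :
    (exchangeOp (fun _ _ => 0) i * exchangeOp (fun _ _ => 0) i :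
      Module.End R (Word L →₀ R)) = 1 := by
  refine wordVec_hom_ext fun x => ?_
  simp

lemma commute_letterOp_exchangeOp (g : L → R) (f : L → L → R) {p i : ℕ} (h₁ : p ≠ i)
    (h₂ : p ≠ i + 1) : Commute (letterOp g p) (exchangeOp f i) := by
  refine wordVec_hom_ext fun x => ?_
  simp only [Module.End.mul_apply, exchangeOp_wordVec, letterOp_wordVec, map_add, map_smul]
  rw [x.letter_exchange_of_ne h₁ h₂]
  module

lemma commute_letterOp_mul_letterOp_exchangeOp (g : L → R) (f : L → L → R) (p : ℕ) :
    Commute (letterOp g p * letterOp g (p + 1)) (exchangeOp f p) := by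
  refine wordVec_hom_ext fun x => ?_
  simp only [Module.End.mul_apply, exchangeOp_wordVec, letterOp_wordVec, map_add, map_smul,
    Word.letter_exchange_left, Word.letter_exchange_right]
  module

lemma exchangeOp_yangBaxter (f g h : L → L → R)
    (h₁ : ∀ a b d, a ≠ b → a ≠ d → b ≠ d → g a d * f d b + h b d * g a b = f a b * h a d)
    (h₂ : ∀ a b d, a ≠ b → a ≠ d → b ≠ d → h b d * f a d = g a d * h b a + f a b * g b d)
    (h₃ : ∀ a b d, a ≠ b → a ≠ d → b ≠ d → h b d * g a b * f b d = f a b * g b d * h a b)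
    (i : ℕ) :
    exchangeOp f (i + 1) * exchangeOp g i * exchangeOp h (i + 1) =
      exchangeOp h i * exchangeOp g (i + 1) * exchangeOp f i := by
  refine wordVec_hom_ext fun x => ?_
  have hright (y : Word L) : (y.exchange i).letter (i + 1 + 1) = y.letter (i + 1 + 1) :=
    y.letter_exchange_of_ne (by omega) (by omega)
  have hleft (y : Word L) : (y.exchange (i + 1)).letter i = y.letter i :=
    y.letter_exchange_of_ne (by omega) (by omega)
  have hab : x.letter i ≠ x.letter (i + 1) := x.injective.ne (by omega)
  have had : x.letter i ≠ x.letter (i + 1 + 1) := x.injective.ne (by omega)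
  have hbd : x.letter (i + 1) ≠ x.letter (i + 1 + 1) := x.injective.ne (by omega)
  simp only [Module.End.mul_apply, exchangeOp_wordVec, map_add, map_smul, hright, hleft,
    Word.letter_exchange_left, Word.letter_exchange_right, Word.exchange_exchange,
    x.exchange_braid]
  linear_combination (norm := module) h₁ _ _ _ hab had hbd • wordVec R (x.exchange (i + 1)) +
    h₂ _ _ _ hab had hbd • wordVec R (x.exchange i) + h₃ _ _ _ hab had hbd • wordVec R x

lemma exchangeOp_mul_eq_mul (f g f' g' : L → L → R)
    (h₁ : ∀ a b, a ≠ b → f b a + g a b = f' b a + g' a b)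
    (h₂ : ∀ a b, a ≠ b → g a b * f a b = g' a b * f' a b) (i : ℕ) :
    exchangeOp f i * exchangeOp g i = exchangeOp f' i * exchangeOp g' i := by
  refine wordVec_hom_ext fun x => ?_
  have hab : x.letter i ≠ x.letter (i + 1) := x.injective.ne (by omega)
  simp only [Module.End.mul_apply, exchangeOp_wordVec, map_add, map_smul,
    Word.letter_exchange_left, Word.letter_exchange_right, Word.exchange_exchange]
  linear_combination (norm := module) h₁ _ _ hab • wordVec R (x.exchange i) +
    h₂ _ _ hab • wordVec R x

end ExchangeOperators

section Products

variable {A : Type*} [Monoid A]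

/-- The product `s_k ⋯ s_1 z`. -/
def leftProduct (z : A) (s : ℕ → A) : ℕ → A
  | 0 => z
  | k + 1 => s (k + 1) * leftProduct z s k

variable {z : A} {s t t' : ℕ → A}

lemma leftProduct_eq_mul (z : A) (s : ℕ → A) (k : ℕ) :
    leftProduct z s k = leftProduct 1 s k * z := by
  induction k with
  | zero => exact (one_mul z).symm
  | succ k ih => rw [leftProduct, leftProduct, ih, mul_assoc]

lemma leftProduct_succ_right (z : A) (s : ℕ → A) (k : ℕ) :
    leftProduct z s (k + 1) = leftProduct (s 1 * z) (fun i => s (i + 1)) k := by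
  induction k with
  | zero => rfl
  | succ k ih => rw [leftProduct, ih, leftProduct]

lemma map_leftProduct {B : Type*} [Monoid B] (f : A →* B) (z : A) (s : ℕ → A) (k : ℕ) :
    f (leftProduct z s k) = leftProduct (f z) (fun i => f (s i)) k := by
  induction k with
  | zero => rfl
  | succ k ih => rw [leftProduct, map_mul, ih, leftProduct]

lemma commute_leftProduct {k : ℕ} {y : A} (hz : Commute y z)
    (hs : ∀ i, 1 ≤ i → i ≤ k → Commute y (s i)) : Commute y (leftProduct z s k) := by
  induction k with
  | zero => exact hz
  | succ k ih =>
    exact (hs _ (by omega) le_rfl).mul_right (ih fun i hi hik => hs i hi (by omega))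

lemma semiconjBy_leftProduct (hst : ∀ i j, i + 1 < j ∨ j + 1 < i → Commute (s i) (t j))
    (hz : ∀ i, 2 ≤ i → Commute z (t i))
    (hshift : ∀ i, SemiconjBy (s (i + 1) * s i) (t (i + 1)) (t i))
    {k i : ℕ} (hi : 1 ≤ i) (hik : i + 1 ≤ k) :
    SemiconjBy (leftProduct z s k) (t (i + 1)) (t i) := by
  induction k with
  | zero => omega
  | succ k ih =>
    rcases Nat.lt_or_ge i k with hlt | hge
    · exact SemiconjBy.mul_left (hst (k + 1) i (by omega)) (ih hlt)
    · obtain ⟨i, rfl⟩ : ∃ j, i = j + 1 := ⟨i - 1, by omega⟩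
      obtain rfl : k = i + 1 := by omega
      rw [leftProduct, leftProduct, ← mul_assoc]
      exact (hshift (i + 1)).mul_left (commute_leftProduct (hz _ (by omega)).symm
        fun j _ _ => (hst _ _ (by omega)).symm).symm

lemma semiconjBy_leftProduct_mul_leftProduct_succ
    (hss : ∀ i j, i + 1 < j ∨ j + 1 < i → Commute (s i) (s j))
    (hz : ∀ i, 2 ≤ i → Commute z (s i))
    (hshift : ∀ i, SemiconjBy (s i * s (i + 1)) (t' i) (t' (i + 1)))
    {y : A} (hone : SemiconjBy (z * s 1 * z) y (t' 1)) (k : ℕ) :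
    SemiconjBy (leftProduct z s k * leftProduct z s (k + 1)) y (t' (k + 1)) := by
  induction k with
  | zero => simpa [leftProduct, mul_assoc] using hone
  | succ k ih =>
    have hc : s (k + 2) * leftProduct z s k = leftProduct z s k * s (k + 2) :=
      commute_leftProduct (hz _ (by omega)).symm fun j _ _ => hss _ _ (by omega)
    have hprod : leftProduct z s (k + 1) * leftProduct z s (k + 2) =
        s (k + 1) * s (k + 2) * (leftProduct z s k * leftProduct z s (k + 1)) := by
      rw [leftProduct.eq_2 z s (k + 1), leftProduct.eq_2 z s k]
      simp only [mul_assoc]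
      rw [← mul_assoc (leftProduct z s k), ← hc]
      simp only [mul_assoc]
    rw [hprod]
    exact (hshift (k + 1)).mul_left ih

lemma semiconjBy_leftProduct_mul_self
    (hss : ∀ i j, i + 1 < j ∨ j + 1 < i → Commute (s i) (s j))
    (hz : ∀ i, 2 ≤ i → Commute z (s i))
    (hshift : ∀ i, SemiconjBy (s i * s (i + 1)) (t' i) (t' (i + 1)))
    (hst : ∀ i, SemiconjBy (s i) (t' i) (t i))
    {y : A} (hone : SemiconjBy (z * s 1 * z) y (t' 1)) (k : ℕ) :
    SemiconjBy (leftProduct z s (k + 1) * leftProduct z s (k + 1)) y (t (k + 1)) := by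
  nth_rw 1 [leftProduct]
  rw [mul_assoc]
  exact (hst (k + 1)).mul_left
    (semiconjBy_leftProduct_mul_leftProduct_succ hss hz hshift hone k)

lemma commute_mul_mul_of_semiconjBy {p u : Aˣ} {x y : A} (hxp : Commute x p)
    (h : SemiconjBy (p * u * (p * u) : A) u y)
    (hx : SemiconjBy (p * u * x * (p * u * x)) (u : A) y) : Commute (x * u * x) (u : A) := by
  have hpup : SemiconjBy (↑(p * u * p) : A) u y := by
    have := h.mul_left (Commute.refl (u : A)).units_inv_left
    simpa [mul_assoc] using this
  have hxux : x * u * x = ↑(p * u * p)⁻¹ * (p * u * x * (p * u * x)) := by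
    rw [Units.eq_inv_mul_iff_mul_eq, Units.val_mul, Units.val_mul]
    simp only [mul_assoc]
    rw [← mul_assoc x p, hxp.eq, mul_assoc]
  rw [hxux]
  exact hpup.units_inv_symm_left.mul_left hx

end Products

/-! ### The representation on coloured words -/

section Representation

variable {R : Type*} [CommRing R] (c : R) {L : Type*} [LinearOrder L] {m : ℕ} (col : L → Fin m)

/-- The coefficients of the operators of the `σ_i`. -/
def sigmaCoeff (a b : L) : R := if b < a then c else 0

/-- The coefficients of the inverses of the operators of the `σ_i`. -/
def sigmaInvCoeff (a b : L) : R := if a < b then -c else 0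

/-- The coefficients of the operators that agree with those of the `σ_i` on letters of the same
colour and exchange letters of different colours. -/
def colourCoeff (a b : L) : R := if col a = col b ∧ b < a then c else 0

/-- The coefficients of the operators of the `σ_i` for the order of the letters in which the order
of the colours is reversed. -/
def sigmaRevCoeff (a b : L) : R := if (col a = col b ∧ b < a) ∨ col a < col b then c else 0

/-- The operator of `σ_i`, for a parameter `c` in place of `q - q⁻¹`. -/
noncomputable abbrev sigmaOp (i : ℕ) : Module.End R (Word L →₀ R) := exchangeOp (sigmaCoeff c) i

/-- The inverse of the operator of `σ_i`. -/
noncomputable abbrev sigmaInvOp (i : ℕ) : Module.End R (Word L →₀ R) :=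
  exchangeOp (sigmaInvCoeff c) i

/-- The operator that agrees with that of `σ_i` on letters of the same colour and exchanges
letters of different colours. -/
noncomputable abbrev colourOp (i : ℕ) : Module.End R (Word L →₀ R) :=
  exchangeOp (colourCoeff c col) i

/-- The operator of `σ_i` for the order of the letters with the reversed order of the colours. -/
noncomputable abbrev sigmaRevOp (i : ℕ) : Module.End R (Word L →₀ R) :=
  exchangeOp (sigmaRevCoeff c col) i

lemma sigmaOp_braid (i : ℕ) : sigmaOp c (i + 1) * sigmaOp c i * sigmaOp c (i + 1) =
    (sigmaOp c i * sigmaOp c (i + 1) * sigmaOp c i : Module.End R (Word L →₀ R)) := by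
  refine exchangeOp_yangBaxter _ _ _ ?_ ?_ ?_ i <;> intros <;>
    simp only [sigmaCoeff] <;> split_ifs <;> first | ring1 | grind

lemma sigmaOp_mul_self (i : ℕ) :
    sigmaOp c i * sigmaOp c i = c • (sigmaOp c i : Module.End R (Word L →₀ R)) + 1 := by
  refine wordVec_hom_ext fun x => ?_
  have hne : x.letter i ≠ x.letter (i + 1) := x.injective.ne (by omega)
  simp only [Module.End.mul_apply, exchangeOp_wordVec, map_add, map_smul,
    Word.letter_exchange_left, Word.letter_exchange_right, Word.exchange_exchange,
    LinearMap.add_apply, LinearMap.smul_apply, Module.End.one_apply, sigmaCoeff]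
  rcases hne.lt_or_gt with h | h <;> simp only [h, h.not_gt, if_true, if_false] <;> module

lemma sigmaOp_mul_sigmaInvOp (i : ℕ) :
    sigmaOp c i * sigmaInvOp c i = (1 : Module.End R (Word L →₀ R)) := by
  rw [← exchangeOp_zero_mul_self i]
  refine exchangeOp_mul_eq_mul _ _ _ _ ?_ ?_ i <;> intros <;>
    simp only [sigmaCoeff, sigmaInvCoeff] <;> split_ifs <;> first | ring1 | grind

lemma sigmaInvOp_mul_sigmaOp (i : ℕ) :
    sigmaInvOp c i * sigmaOp c i = (1 : Module.End R (Word L →₀ R)) := by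
  rw [← exchangeOp_zero_mul_self i]
  refine exchangeOp_mul_eq_mul _ _ _ _ ?_ ?_ i <;> intros <;>
    simp only [sigmaCoeff, sigmaInvCoeff] <;> split_ifs <;> first | ring1 | grind

variable {col} in
lemma colourOp_mul_sigmaRevOp (hcol : Monotone col) (i : ℕ) :
    colourOp c col i * sigmaRevOp c col i = sigmaOp c i * colourOp c col i := by
  have hlt (a b : L) : col a < col b → a < b := hcol.reflect_lt
  refine exchangeOp_mul_eq_mul _ _ _ _ ?_ ?_ i <;> intros <;>
    simp only [sigmaCoeff, sigmaRevCoeff, colourCoeff] <;> split_ifs <;> first | ring1 | grind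

variable {col} in
lemma colourOp_mul_sigmaOp (hcol : Monotone col) (i : ℕ) :
    colourOp c col i * sigmaOp c i = sigmaRevOp c col i * colourOp c col i := by
  have hlt (a b : L) : col a < col b → a < b := hcol.reflect_lt
  refine exchangeOp_mul_eq_mul _ _ _ _ ?_ ?_ i <;> intros <;>
    simp only [sigmaCoeff, sigmaRevCoeff, colourCoeff] <;> split_ifs <;> first | ring1 | grind

variable {col} in
lemma semiconjBy_colourOp_sigmaOp (hcol : Monotone col) (i : ℕ) :
    SemiconjBy (colourOp c col (i + 1) * colourOp c col i) (sigmaOp c (i + 1)) (sigmaOp c i) := by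
  have hlt (a b : L) : col a < col b → a < b := hcol.reflect_lt
  rw [SemiconjBy, ← mul_assoc]
  refine exchangeOp_yangBaxter _ _ _ ?_ ?_ ?_ i <;> intros <;>
    simp only [sigmaCoeff, colourCoeff] <;> split_ifs <;> first | ring1 | grind

lemma semiconjBy_colourOp_sigmaRevOp (i : ℕ) :
    SemiconjBy (colourOp c col i * colourOp c col (i + 1)) (sigmaRevOp c col i)
      (sigmaRevOp c col (i + 1)) := by
  rw [SemiconjBy, ← mul_assoc, eq_comm]
  refine exchangeOp_yangBaxter _ _ _ ?_ ?_ ?_ i <;> intros <;>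
    simp only [sigmaRevCoeff, colourCoeff] <;> split_ifs <;> first | ring1 | grind

/-- The operator of `σ_i` as a unit. -/
noncomputable def sigmaUnit (i : ℕ) : (Module.End R (Word L →₀ R))ˣ :=
  ⟨sigmaOp c i, sigmaInvOp c i, sigmaOp_mul_sigmaInvOp c i, sigmaInvOp_mul_sigmaOp c i⟩

variable (v : Fin m → R)

/-- Multiplication by the parameter attached to the colour of the letter at position `p`. -/
noncomputable abbrev colourEval (p : ℕ) : Module.End R (Word L →₀ R) :=
  letterOp (fun a => v (col a)) p

/-- The operator of `τ` on words, of which the letters at the positions `1, …, k + 1` are used: the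
product `σ_1⁻¹ ⋯ σ_k⁻¹ ρ_k ⋯ ρ_1 ω`, where `ρ_i` is `colourOp c col i` and `ω` is
`colourEval col v 1`. -/
noncomputable def tauOp (k : ℕ) : Module.End R (Word L →₀ R) :=
  ((leftProduct 1 (sigmaUnit c) k)⁻¹ : (Module.End R (Word L →₀ R))ˣ) *
    leftProduct (colourEval col v 1) (colourOp c col) k

lemma coe_leftProduct_sigmaUnit (k : ℕ) :
    (↑(leftProduct 1 (sigmaUnit c) k : (Module.End R (Word L →₀ R))ˣ) :
      Module.End R (Word L →₀ R)) = leftProduct 1 (sigmaOp c) k :=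
  map_leftProduct (Units.coeHom _) _ _ _

lemma leftProduct_sigmaUnit_mul_tauOp (k : ℕ) :
    leftProduct 1 (sigmaUnit (L := L) c) k * tauOp c col v k =
      leftProduct (colourEval col v 1) (colourOp c col) k :=
  Units.mul_inv_cancel_left _ _

variable {col}

lemma commute_tauOp_sigmaOp (hcol : Monotone col) {k i : ℕ} (hi : 2 ≤ i) (hik : i ≤ k) :
    Commute (tauOp c col v k) (sigmaOp c i) := by
  obtain ⟨i, rfl⟩ : ∃ j, i = j + 1 := ⟨i - 1, by omega⟩
  have hsigma : SemiconjBy (leftProduct 1 (sigmaUnit (L := L) c) k).val (sigmaOp c (i + 1))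
      (sigmaOp c i) := by
    rw [coe_leftProduct_sigmaUnit]
    exact semiconjBy_leftProduct (fun _ _ => commute_exchangeOp) (fun _ _ => Commute.one_left _)
      (fun i => by rw [SemiconjBy, ← mul_assoc, sigmaOp_braid, mul_assoc]) (by omega) hik
  have hcolour : SemiconjBy (leftProduct (colourEval col v 1) (colourOp c col) k)
      (sigmaOp c (i + 1)) (sigmaOp c i) :=
    semiconjBy_leftProduct (fun _ _ => commute_exchangeOp)
      (fun _ _ => commute_letterOp_exchangeOp _ _ (by omega) (by omega))
      (semiconjBy_colourOp_sigmaOp c hcol) (by omega) hik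
  exact hsigma.units_inv_symm_left.mul_left hcolour

lemma colourEval_mul_colourOp_mul_colourEval :
    colourEval col v 1 * colourOp c col 1 * colourEval col v 1 =
      colourOp c col 1 * (colourEval col v 1 * colourEval col v 2) := by
  refine wordVec_hom_ext fun x => ?_
  simp only [Module.End.mul_apply, exchangeOp_wordVec, letterOp_wordVec, map_add, map_smul,
    Word.letter_exchange_left, colourCoeff]
  split_ifs with h
  · rw [h.1]
    module
  · module

lemma semiconjBy_colourEval_mul_colourOp_mul_colourEval (hcol : Monotone col) :
    SemiconjBy (colourEval col v 1 * colourOp c col 1 * colourEval col v 1) (sigmaOp c 1)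
      (sigmaRevOp c col 1) := by
  rw [colourEval_mul_colourOp_mul_colourEval]
  exact SemiconjBy.mul_left (colourOp_mul_sigmaOp c hcol 1)
    (commute_letterOp_mul_letterOp_exchangeOp _ _ 1)

lemma tauOp_braid (hcol : Monotone col) (k : ℕ) :
    Commute (tauOp c col v (k + 1) * sigmaOp c 1 * tauOp c col v (k + 1)) (sigmaOp c 1) := by
  have hfactor : leftProduct 1 (sigmaUnit (L := L) c) (k + 1) =
      leftProduct 1 (fun i => sigmaUnit c (i + 1)) k * sigmaUnit c 1 := by
    rw [leftProduct_succ_right, mul_one, leftProduct_eq_mul]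
  refine commute_mul_mul_of_semiconjBy (u := sigmaUnit c 1) (y := sigmaOp c (k + 1))
    (p := leftProduct 1 (fun i => sigmaUnit c (i + 1)) k) ?_ ?_ ?_
  · rw [← Units.coeHom_apply, map_leftProduct]
    exact commute_leftProduct (Commute.one_right _) fun i _ _ =>
      commute_tauOp_sigmaOp c v hcol (by omega) (by omega)
  · rw [← Units.val_mul, ← hfactor, coe_leftProduct_sigmaUnit]
    exact semiconjBy_leftProduct_mul_self (t' := sigmaOp c) (fun _ _ => commute_exchangeOp)
      (fun _ _ => Commute.one_left _)
      (fun i => by rw [SemiconjBy, ← mul_assoc, sigmaOp_braid, mul_assoc])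
      (fun _ => Commute.refl _)
      (by rw [one_mul, mul_one]; exact Commute.refl _) k
  · rw [← Units.val_mul, ← hfactor, leftProduct_sigmaUnit_mul_tauOp]
    exact semiconjBy_leftProduct_mul_self (fun _ _ => commute_exchangeOp)
      (fun _ _ => commute_letterOp_exchangeOp _ _ (by omega) (by omega))
      (semiconjBy_colourOp_sigmaRevOp c col) (colourOp_mul_sigmaRevOp c hcol)
      (semiconjBy_colourEval_mul_colourOp_mul_colourEval c v hcol) k

end Representation

/-! ### The cyclotomic relation -/

section LetterSpan

variable {R : Type*} [CommRing R] {L : Type*}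

/-- The span of the words whose letter at position `p` satisfies `P`. -/
noncomputable def letterSpan (R : Type*) [CommRing R] {L : Type*} (P : L → Prop) (p : ℕ) :
    Submodule R (Word L →₀ R) :=
  Submodule.span R {y | ∃ x : Word L, P (x.letter p) ∧ y = wordVec R x}

lemma wordVec_mem_letterSpan {P : L → Prop} {p : ℕ} {x : Word L} (hx : P (x.letter p)) :
    wordVec R x ∈ letterSpan R P p :=
  Submodule.subset_span ⟨x, hx, rfl⟩

lemma letterSpan_le {P : L → Prop} {p : ℕ} {N : Submodule R (Word L →₀ R)}
    (h : ∀ x : Word L, P (x.letter p) → wordVec R x ∈ N) : letterSpan R P p ≤ N := by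
  rw [letterSpan, Submodule.span_le]
  rintro _ ⟨x, hx, rfl⟩
  exact h x hx

lemma letterSpan_mono {P Q : L → Prop} (h : ∀ a, P a → Q a) (p : ℕ) :
    letterSpan R P p ≤ letterSpan R Q p :=
  letterSpan_le fun _ hx => wordVec_mem_letterSpan (h _ hx)

lemma letterSpan_succ_le_comap_exchangeOp {P : L → Prop} {f : L → L → R}
    (hf : ∀ a b, f a b ≠ 0 → P b → P a) (p : ℕ) :
    letterSpan R P (p + 1) ≤ (letterSpan R P p).comap (exchangeOp f p) := by
  refine letterSpan_le fun x hx => ?_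
  rw [Submodule.mem_comap, exchangeOp_wordVec]
  refine add_mem (wordVec_mem_letterSpan (by rwa [Word.letter_exchange_left])) ?_
  by_cases h : f (x.letter p) (x.letter (p + 1)) = 0
  · rw [h, zero_smul]
    exact zero_mem _
  · exact Submodule.smul_mem _ _ (wordVec_mem_letterSpan (hf _ _ h hx))

lemma letterSpan_le_comap_exchangeOp {P : L → Prop} {f : L → L → R}
    (hf : ∀ a b, f a b ≠ 0 → P a → P b) (p : ℕ) :
    letterSpan R P p ≤ (letterSpan R P (p + 1)).comap (exchangeOp f p) := by
  refine letterSpan_le fun x hx => ?_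
  rw [Submodule.mem_comap, exchangeOp_wordVec]
  refine add_mem (wordVec_mem_letterSpan (by rwa [Word.letter_exchange_right])) ?_
  by_cases h : f (x.letter p) (x.letter (p + 1)) = 0
  · rw [h, zero_smul]
    exact zero_mem _
  · exact Submodule.smul_mem _ _ (wordVec_mem_letterSpan (hf _ _ h hx))

end LetterSpan

section Cyclotomic

variable {R : Type*} [CommRing R] (c : R) {L : Type*} [LinearOrder L] {m : ℕ} {col : L → Fin m}

lemma inv_leftProduct_sigmaUnit_mem_letterSpan (hcol : Monotone col) (γ k : ℕ)
    {y : Word L →₀ R} (hy : y ∈ letterSpan R (fun a => (col a : ℕ) < γ) (k + 1)) :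
    (leftProduct 1 (sigmaUnit (L := L) c) k)⁻¹.val y ∈
      letterSpan R (fun a => (col a : ℕ) < γ) 1 := by
  induction k generalizing y with
  | zero => simpa [leftProduct] using hy
  | succ k ih =>
    rw [leftProduct, mul_inv_rev, Units.val_mul, Module.End.mul_apply]
    refine ih (letterSpan_succ_le_comap_exchangeOp (P := fun a => (col a : ℕ) < γ)
      (f := sigmaInvCoeff c) (fun a b hab hb => ?_) (k + 1) hy)
    have hlt : a < b := by
      by_contra h
      exact hab (if_neg h)
    exact lt_of_le_of_lt (hcol hlt.le) hb

lemma leftProduct_colourOp_mem_letterSpan (j : Fin m) (k : ℕ) {y : Word L →₀ R}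
    (hy : y ∈ letterSpan R (fun a => col a = j) 1) :
    leftProduct 1 (colourOp c col) k y ∈ letterSpan R (fun a => col a = j) (k + 1) := by
  induction k with
  | zero => exact hy
  | succ k ih =>
    rw [leftProduct, Module.End.mul_apply]
    refine letterSpan_le_comap_exchangeOp (P := fun a => col a = j) (f := colourCoeff c col)
      (fun a b hab ha => ?_) (k + 1) ih
    have heq : col a = col b := by
      by_contra h
      exact hab (if_neg fun h' => h h'.1)
    exact heq.symm.trans ha

lemma sigmaInvOp_mul_colourOp_sub_one_mem (hcol : Monotone col) (p : ℕ) (x : Word L) :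
    (sigmaInvOp c p * colourOp c col p - 1 : Module.End R (Word L →₀ R)) (wordVec R x) ∈
      letterSpan R (fun a => (col a : ℕ) < col (x.letter p)) p := by
  have hexpand :
      (sigmaInvOp c p * colourOp c col p - 1 : Module.End R (Word L →₀ R)) (wordVec R x) =
        (sigmaInvCoeff c (x.letter (p + 1)) (x.letter p) +
          colourCoeff c col (x.letter p) (x.letter (p + 1))) • wordVec R (x.exchange p) +
        (colourCoeff c col (x.letter p) (x.letter (p + 1)) *
          sigmaInvCoeff c (x.letter p) (x.letter (p + 1))) • wordVec R x := by
    simp only [LinearMap.sub_apply, Module.End.mul_apply, exchangeOp_wordVec, map_add, map_smul,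
      Word.letter_exchange_left, Word.letter_exchange_right, Word.exchange_exchange,
      Module.End.one_apply]
    module
  have hdiag : colourCoeff c col (x.letter p) (x.letter (p + 1)) *
      sigmaInvCoeff c (x.letter p) (x.letter (p + 1)) = 0 := by
    simp only [colourCoeff, sigmaInvCoeff]
    split_ifs <;> first | ring1 | grind
  rw [hexpand, hdiag, zero_smul, add_zero]
  by_cases h : x.letter (p + 1) < x.letter p ∧ col (x.letter p) ≠ col (x.letter (p + 1))
  · refine Submodule.smul_mem _ _ (wordVec_mem_letterSpan ?_)
    rw [Word.letter_exchange_left]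
    exact Fin.lt_def.1 (lt_of_le_of_ne (hcol h.1.le) h.2.symm)
  · have hzero : sigmaInvCoeff c (x.letter (p + 1)) (x.letter p) +
        colourCoeff c col (x.letter p) (x.letter (p + 1)) = 0 := by
      simp only [colourCoeff, sigmaInvCoeff]
      split_ifs <;> first | ring1 | grind
    rw [hzero, zero_smul]
    exact zero_mem _

lemma mul_mul_mul_sub_one {A : Type*} [Ring A] (x y z w : A) :
    x * y * (z * w) - 1 = x * ((y * z - 1) * w) + (x * w - 1) := by
  noncomm_ring

lemma inv_leftProduct_sigmaUnit_mul_leftProduct_colourOp_sub_one_mem (hcol : Monotone col)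
    (k : ℕ) (x : Word L) :
    ((leftProduct 1 (sigmaUnit (L := L) c) k)⁻¹.val * leftProduct 1 (colourOp c col) k - 1)
        (wordVec R x) ∈
      letterSpan R (fun a => (col a : ℕ) < col (x.letter 1)) 1 := by
  induction k with
  | zero => simp [leftProduct]
  | succ k ih =>
    have hsplit : (leftProduct 1 (sigmaUnit (L := L) c) (k + 1))⁻¹.val *
          leftProduct 1 (colourOp c col) (k + 1) - 1 =
        (leftProduct 1 (sigmaUnit (L := L) c) k)⁻¹.val *
          ((sigmaInvOp c (k + 1) * colourOp c col (k + 1) - 1) *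
            leftProduct 1 (colourOp c col) k) +
        ((leftProduct 1 (sigmaUnit (L := L) c) k)⁻¹.val * leftProduct 1 (colourOp c col) k -
          1) := by
      have hinv : (sigmaUnit (L := L) c (k + 1))⁻¹.val = sigmaInvOp c (k + 1) := rfl
      rw [leftProduct, leftProduct, mul_inv_rev, Units.val_mul, hinv]
      exact mul_mul_mul_sub_one (A := Module.End R (Word L →₀ R)) _ _ _ _
    rw [hsplit, LinearMap.add_apply]
    refine add_mem (inv_leftProduct_sigmaUnit_mem_letterSpan c hcol _ k ?_) ih
    rw [Module.End.mul_apply]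
    have hmem := leftProduct_colourOp_mem_letterSpan c (col (x.letter 1)) k
      (wordVec_mem_letterSpan (R := R) (P := fun a => col a = col (x.letter 1)) (p := 1) rfl)
    suffices hle : letterSpan R (fun a => col a = col (x.letter 1)) (k + 1) ≤
        (letterSpan R (fun a => (col a : ℕ) < col (x.letter 1)) (k + 1)).comap
          (sigmaInvOp c (k + 1) * colourOp c col (k + 1) - 1) from hle hmem
    refine letterSpan_le fun y hy => ?_
    rw [Submodule.mem_comap, ← hy]
    exact sigmaInvOp_mul_colourOp_sub_one_mem c hcol _ _

variable (v : Fin m → R)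

lemma tauOp_wordVec_sub_smul_mem (hcol : Monotone col) (k : ℕ) (x : Word L) :
    tauOp c col v k (wordVec R x) - v (col (x.letter 1)) • wordVec R x ∈
      letterSpan R (fun a => (col a : ℕ) < col (x.letter 1)) 1 := by
  rw [tauOp, leftProduct_eq_mul (colourEval col v 1), ← mul_assoc, Module.End.mul_apply,
    letterOp_wordVec, map_smul, ← smul_sub]
  exact Submodule.smul_mem _ _
    (inv_leftProduct_sigmaUnit_mul_leftProduct_colourOp_sub_one_mem c hcol k x)

lemma tauOp_sub_algebraMap_mem_letterSpan (hcol : Monotone col) (k : ℕ) (j : Fin m)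
    {y : Word L →₀ R} (hy : y ∈ letterSpan R (fun a => (col a : ℕ) < j + 1) 1) :
    (tauOp c col v k - algebraMap R (Module.End R (Word L →₀ R)) (v j)) y ∈
      letterSpan R (fun a => (col a : ℕ) < j) 1 := by
  suffices hle : letterSpan R (fun a => (col a : ℕ) < j + 1) 1 ≤
      (letterSpan R (fun a => (col a : ℕ) < j) 1).comap
        (tauOp c col v k - algebraMap R (Module.End R (Word L →₀ R)) (v j)) from hle hy
  refine letterSpan_le fun x hx => ?_
  have hsplit :
      (tauOp c col v k - algebraMap R (Module.End R (Word L →₀ R)) (v j)) (wordVec R x) =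
        (tauOp c col v k (wordVec R x) - v (col (x.letter 1)) • wordVec R x) +
          (v (col (x.letter 1)) - v j) • wordVec R x := by
    rw [LinearMap.sub_apply, Module.algebraMap_end_apply]
    module
  rw [Submodule.mem_comap, hsplit]
  refine add_mem (letterSpan_mono (fun a ha => by omega) 1
    (tauOp_wordVec_sub_smul_mem c v hcol k x)) ?_
  rcases Nat.lt_succ_iff_lt_or_eq.1 hx with h | h
  · exact Submodule.smul_mem _ _ (wordVec_mem_letterSpan h)
  · rw [Fin.ext h, sub_self, zero_smul]
    exact zero_mem _

lemma prod_ofFn_apply_mem {M : Type*} [AddCommMonoid M] [Module R M] (N : ℕ → Submodule R M)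
    {m : ℕ} {f : Fin m → Module.End R M} (h : ∀ j : Fin m, ∀ y ∈ N (j + 1), f j y ∈ N j)
    {y : M} (hy : y ∈ N m) : (List.ofFn f).prod y ∈ N 0 := by
  induction m generalizing y with
  | zero => simpa using hy
  | succ m ih =>
    rw [List.ofFn_succ', List.concat_eq_append, List.prod_append, List.prod_singleton,
      Module.End.mul_apply]
    exact ih (fun j => h j.castSucc) (h (Fin.last m) y hy)

lemma tauOp_cyclotomic (hcol : Monotone col) (k : ℕ) :
    (List.ofFn fun j : Fin m => tauOp c col v k -
      algebraMap R (Module.End R (Word L →₀ R)) (v j)).prod = 0 := by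
  refine wordVec_hom_ext fun x => ?_
  have hmem := prod_ofFn_apply_mem (fun γ => letterSpan R (fun a => (col a : ℕ) < γ) 1)
    (fun j y => tauOp_sub_algebraMap_mem_letterSpan c v hcol k j)
    (wordVec_mem_letterSpan (R := R) (col (x.letter 1)).is_lt)
  exact (Submodule.mem_bot R).1 (letterSpan_le (fun _ hx => absurd hx (Nat.not_lt_zero _)) hmem)

theorem isHeckeSystem_tauOp_sigmaOp (hcol : Monotone col) (n : ℕ) :
    IsHeckeSystem c v n (tauOp c col v (n - 1))
      (sigmaOp c : ℕ → Module.End R (Word L →₀ R)) where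
  braid i _ _ := (sigmaOp_braid c i).symm
  comm i j _ hij _ := commute_exchangeOp_of_lt _ _ hij
  tau_braid hn := by
    obtain ⟨k, hk⟩ : ∃ k, n - 1 = k + 1 := ⟨n - 2, by omega⟩
    rw [hk, (tauOp_braid c v hcol k).eq]
    simp only [mul_assoc]
  tau_comm i hi hin := commute_tauOp_sigmaOp c v hcol hi (by omega)
  quadratic i _ _ := sigmaOp_mul_self c i
  cyclotomic _ := tauOp_cyclotomic c v hcol (n - 1)

end Cyclotomic

/-! ### Change of the base ring -/

section BaseChange

variable {R F : Type*} [CommRing R] [CommRing F] (φ : R →+* F) {L : Type*}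

/-- Apply a ring homomorphism to the coefficients of a combination of words. -/
noncomputable def mapCoeff : (Word L →₀ R) →ₛₗ[φ] (Word L →₀ F) :=
  Finsupp.mapRange.linearMap φ.toSemilinearMap

@[simp] lemma mapCoeff_wordVec (x : Word L) : mapCoeff φ (wordVec R x) = wordVec F x := by
  simp [mapCoeff, wordVec]

lemma semiconj_mapCoeff {A : Module.End R (Word L →₀ R)} {B : Module.End F (Word L →₀ F)}
    (h : ∀ x, mapCoeff φ (A (wordVec R x)) = B (wordVec F x)) :
    Function.Semiconj (mapCoeff φ) A B := by
  intro y
  induction y using Finsupp.induction_linear with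
  | zero => simp
  | add y z hy hz => simp only [map_add, hy, hz]
  | single x r =>
    have hsingle : Finsupp.single x r = r • wordVec R x := by simp [wordVec]
    rw [hsingle, map_smul, map_smulₛₗ, h, map_smulₛₗ, map_smul, mapCoeff_wordVec]

lemma semiconj_mapCoeff_exchangeOp {f : L → L → R} {g : L → L → F}
    (h : ∀ a b, φ (f a b) = g a b) (i : ℕ) :
    Function.Semiconj (mapCoeff φ) (exchangeOp f i) (exchangeOp g i) :=
  semiconj_mapCoeff φ fun x => by simp [h]

lemma semiconj_mapCoeff_leftProduct {z : Module.End R (Word L →₀ R)}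
    {z' : Module.End F (Word L →₀ F)} {s : ℕ → Module.End R (Word L →₀ R)}
    {s' : ℕ → Module.End F (Word L →₀ F)} (hz : Function.Semiconj (mapCoeff φ) z z')
    (hs : ∀ i, Function.Semiconj (mapCoeff φ) (s i) (s' i)) (k : ℕ) :
    Function.Semiconj (mapCoeff φ) (leftProduct z s k :) (leftProduct z' s' k :) := by
  induction k with
  | zero => exact hz
  | succ k ih => exact (hs (k + 1)).comp_right ih

variable [LinearOrder L] (c : R)

lemma semiconj_mapCoeff_sigmaOp (i : ℕ) :
    Function.Semiconj (mapCoeff φ) (sigmaOp (L := L) c i) (sigmaOp (φ c) i) :=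
  semiconj_mapCoeff_exchangeOp φ
    (fun a b => by rw [sigmaCoeff, apply_ite φ, map_zero, sigmaCoeff]) i

lemma semiconj_mapCoeff_inv_leftProduct_sigmaUnit (k : ℕ) :
    Function.Semiconj (mapCoeff φ)
      (leftProduct 1 (sigmaUnit (L := L) c) k)⁻¹.val
      (leftProduct 1 (sigmaUnit (L := L) (φ c)) k)⁻¹.val := by
  refine Function.Semiconj.inverses_right
    (ga := (leftProduct 1 (sigmaUnit c) k).val)
    (gb := (leftProduct 1 (sigmaUnit (φ c)) k).val)
    ?_ (fun y => ?_) fun y => ?_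
  · rw [coe_leftProduct_sigmaUnit, coe_leftProduct_sigmaUnit]
    exact semiconj_mapCoeff_leftProduct φ (semiconj_mapCoeff φ (mapCoeff_wordVec φ))
      (semiconj_mapCoeff_sigmaOp φ c) k
  · rw [← Module.End.mul_apply, Units.mul_inv, Module.End.one_apply]
  · rw [← Module.End.mul_apply, Units.inv_mul, Module.End.one_apply]

lemma semiconj_mapCoeff_tauOp {m : ℕ} (col : L → Fin m) (v : Fin m → R) (k : ℕ) :
    Function.Semiconj (mapCoeff φ) (tauOp c col v k) (tauOp (φ c) col (φ ∘ v) k) := by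
  refine (semiconj_mapCoeff_inv_leftProduct_sigmaUnit φ c k).comp_right ?_
  refine semiconj_mapCoeff_leftProduct φ (semiconj_mapCoeff φ fun x => ?_) (fun i => ?_) k
  · rw [letterOp_wordVec, letterOp_wordVec, map_smulₛₗ, mapCoeff_wordVec, Function.comp_apply]
  · exact semiconj_mapCoeff_exchangeOp φ
      (fun a b => by rw [colourCoeff, apply_ite φ, map_zero, colourCoeff]) i

end BaseChange

/-! ### The undeformed operators -/

section Undeformed

section CommRing

variable {R : Type*} [CommRing R] {L : Type*}

lemma aeval_letterOp (g : L → R) (p : ℕ) (P : Polynomial R) :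
    Polynomial.aeval (letterOp g p) P = letterOp (fun a => P.eval (g a)) p := by
  induction P using Polynomial.induction_on with
  | C r =>
    refine wordVec_hom_ext fun x => ?_
    simp
  | add P Q hP hQ =>
    refine wordVec_hom_ext fun x => ?_
    simp [hP, hQ, add_smul]
  | monomial k r ih =>
    rw [pow_succ', mul_left_comm, map_mul, ih, Polynomial.aeval_X]
    refine wordVec_hom_ext fun x => ?_
    simp only [Module.End.mul_apply, letterOp_wordVec, map_smul, smul_smul, Polynomial.eval_mul,
      Polynomial.eval_X, mul_comm]

variable [LinearOrder L]

lemma sigmaOp_zero_wordVec (i : ℕ) (x : Word L) :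
    sigmaOp (0 : R) i (wordVec R x) = wordVec R (x.exchange i) := by
  simp [sigmaCoeff]

lemma tauOp_zero {m : ℕ} (col : L → Fin m) (v : Fin m → R) (k : ℕ) :
    tauOp 0 col v k = colourEval col v 1 := by
  have hcolour : colourOp (0 : R) col = sigmaOp 0 := by
    funext i
    refine wordVec_hom_ext fun x => ?_
    simp [sigmaCoeff, colourCoeff]
  rw [tauOp, leftProduct_eq_mul (colourEval col v 1), hcolour, ← coe_leftProduct_sigmaUnit,
    Units.inv_mul_cancel_left]

lemma sigmaOp_zero_conj_letterOp (g : L → R) (p : ℕ) :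
    sigmaOp (0 : R) p * letterOp g p * sigmaOp (0 : R) p = letterOp g (p + 1) := by
  refine wordVec_hom_ext fun x => ?_
  simp [sigmaCoeff]

lemma le_comap_letterOp {K : Submodule R (Word L →₀ R)} {n : ℕ}
    (hσ : ∀ i, 1 ≤ i → i + 1 ≤ n → K ≤ K.comap (sigmaOp (0 : R) i)) {g : L → R}
    (hg : 1 ≤ n → K ≤ K.comap (letterOp g 1)) {p : ℕ} (hp : 1 ≤ p) (hpn : p ≤ n) :
    K ≤ K.comap (letterOp g p) := by
  induction p, hp using Nat.le_induction with
  | base => exact hg hpn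
  | succ p hp ih =>
    rw [← sigmaOp_zero_conj_letterOp]
    exact fun y hy => hσ p hp hpn (ih (by omega) (hσ p hp hpn hy))

end CommRing

/- Interpolation at the distinct parameters `v j` makes the projection to the words with a given
colour at a given position a polynomial in the diagonal operator `colourEval`. -/
lemma le_comap_letterOp_colour {F : Type*} [Field F] {L : Type*} [LinearOrder L] {m : ℕ}
    (col : L → Fin m) {v : Fin m → F} (hv : Function.Injective v) {K : Submodule F (Word L →₀ F)}
    {n : ℕ} (hσ : ∀ i, 1 ≤ i → i + 1 ≤ n → K ≤ K.comap (sigmaOp (0 : F) i))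
    (hτ : 1 ≤ n → K ≤ K.comap (colourEval col v 1)) {p : ℕ} (hp : 1 ≤ p) (hpn : p ≤ n)
    (j : Fin m) : K ≤ K.comap (letterOp (fun a => if col a = j then 1 else 0) p) := by
  have hbasis : Polynomial.aeval (colourEval col v p) (Lagrange.basis Finset.univ v j) =
      letterOp (fun a => if col a = j then 1 else 0) p := by
    rw [aeval_letterOp]
    congr 1 with a
    split_ifs with ha
    · rw [ha, Lagrange.eval_basis_self hv.injOn (Finset.mem_univ _)]
    · rw [Lagrange.eval_basis_of_ne (Ne.symm ha) (Finset.mem_univ _)]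
  intro y hy
  rw [Submodule.mem_comap, ← hbasis]
  exact Polynomial.aeval_apply_smul_mem_of_le_comap hy _ _ (le_comap_letterOp hσ hτ hp hpn)

end Undeformed

/-! ### The cyclic vector and linear independence -/

section ColouredPermutations

/-- The letters: pairs of a colour and a label, ordered lexicographically. -/
abbrev Letter (m : ℕ) : Type := Fin m ×ₗ ℕ

/-- The colour of a letter. -/
def letterColour {m : ℕ} (a : Letter m) : Fin m := (ofLex a).1

lemma letterColour_mono {m : ℕ} : Monotone (letterColour : Letter m → Fin m) :=
  Prod.Lex.monotone_fst_ofLex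

variable {m n : ℕ}

/-- The embedding of `Fin n` onto the positions `1, …, n`. -/
def positionEmbedding (n : ℕ) : Fin n ↪ ℕ :=
  ⟨fun i => i + 1, fun _ _ h => Fin.ext (Nat.succ_injective h)⟩

/-- The word of a coloured permutation `(γ, w)` of `1, …, n`: its labels are the values of `w`, the
label `i` has the colour `γ i`, and outside of `1, …, n` all labels have the first colour. -/
noncomputable def permWord (hm : 1 ≤ m) (g : (Fin n → Fin m) × Equiv.Perm (Fin n)) :
    Word (Letter m) where
  letter p := toLex (Function.extend (positionEmbedding n) g.1 (fun _ => ⟨0, hm⟩)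
    (g.2.viaEmbedding (positionEmbedding n) p), g.2.viaEmbedding (positionEmbedding n) p)
  injective _ _ h := Equiv.injective _ (congrArg (fun a => (ofLex a).2) h)

lemma permWord_letter_positionEmbedding (hm : 1 ≤ m) (γ : Fin n → Fin m)
    (w : Equiv.Perm (Fin n)) (i : Fin n) :
    (permWord hm (γ, w)).letter (positionEmbedding n i) =
      toLex (γ (w i), positionEmbedding n (w i)) := by
  simp only [permWord, Equiv.Perm.viaEmbedding_apply,
    (positionEmbedding n).injective.extend_apply]

lemma permWord_injective (hm : 1 ≤ m) :
    Function.Injective (permWord hm : (Fin n → Fin m) × Equiv.Perm (Fin n) → _) := by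
  rintro ⟨γ, w⟩ ⟨γ', w'⟩ h
  have hletter (i : Fin n) : (γ (w i), positionEmbedding n (w i)) =
      (γ' (w' i), positionEmbedding n (w' i)) := by
    rw [← toLex_inj, ← permWord_letter_positionEmbedding hm, h,
      permWord_letter_positionEmbedding]
  obtain rfl : w = w' :=
    Equiv.ext fun i => (positionEmbedding n).injective (congrArg Prod.snd (hletter i))
  have hγ : γ ∘ w = γ' ∘ w := funext fun i => congrArg Prod.fst (hletter i)
  rw [w.surjective.injective_comp_right hγ]

lemma viaEmbedding_positionEmbedding_swap (i : Fin n) :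
    (Equiv.swap i.castSucc i.succ).viaEmbedding (positionEmbedding (n + 1)) =
      Equiv.swap ((i : ℕ) + 1) (i + 1 + 1) := by
  ext p
  by_cases hp : p ∈ Set.range (positionEmbedding (n + 1))
  · obtain ⟨j, rfl⟩ := hp
    rw [Equiv.Perm.viaEmbedding_apply]
    exact ((positionEmbedding (n + 1)).swap_apply _ _ _).symm
  · rw [Equiv.Perm.viaEmbedding_apply_of_notMem _ _ _ hp, Equiv.swap_apply_of_ne_of_ne]
    · rintro rfl
      exact hp ⟨i.castSucc, rfl⟩
    · rintro rfl
      exact hp ⟨i.succ, rfl⟩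

lemma permWord_exchange (hm : 1 ≤ m) (γ : Fin (n + 1) → Fin m) (w : Equiv.Perm (Fin (n + 1)))
    (i : Fin n) : (permWord hm (γ, w)).exchange (i + 1) =
      permWord hm (γ, w * Equiv.swap i.castSucc i.succ) := by
  have hmul : (w * Equiv.swap i.castSucc i.succ).viaEmbedding (positionEmbedding (n + 1)) =
      w.viaEmbedding (positionEmbedding (n + 1)) * Equiv.swap ((i : ℕ) + 1) (i + 1 + 1) := by
    rw [← viaEmbedding_positionEmbedding_swap]
    exact (Equiv.Perm.viaEmbeddingHom (positionEmbedding (n + 1))).map_mul _ _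
  ext p : 2
  simp only [permWord, hmul]
  rfl

/-- The sum of the words with the labels in increasing order, over all colourings. -/
noncomputable def cyclicVector (R : Type*) [CommRing R] (hm : 1 ≤ m) (n : ℕ) :
    Word (Letter m) →₀ R :=
  ∑ γ : Fin n → Fin m, wordVec R (permWord hm (γ, 1))

section CyclicVector

variable {F : Type*} [Field F] (hm : 1 ≤ m) {v : Fin m → F} {K : Submodule F (Word (Letter m) →₀ F)}

lemma wordVec_permWord_one_mem (hv : Function.Injective v)
    (hσ : ∀ i, 1 ≤ i → i + 1 ≤ n → K ≤ K.comap (sigmaOp (0 : F) i))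
    (hτ : 1 ≤ n → K ≤ K.comap (colourEval letterColour v 1)) (hu : cyclicVector F hm n ∈ K)
    (γ : Fin n → Fin m) : wordVec F (permWord hm (γ, 1)) ∈ K := by
  suffices h : ∀ s : Finset (Fin n),
      ∑ γ' with ∀ i ∈ s, γ' i = γ i, wordVec F (permWord hm (γ', 1)) ∈ K by
    simpa [← funext_iff, Finset.filter_eq'] using h Finset.univ
  intro s
  induction s using Finset.induction_on with
  | empty => simpa [cyclicVector] using hu
  | insert i s _ ih =>
    have hcolour (γ' : Fin n → Fin m) :
        letterColour ((permWord hm (γ', 1)).letter (i + 1)) = γ' i :=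
      congrArg letterColour (permWord_letter_positionEmbedding hm γ' 1 i)
    have hproj := le_comap_letterOp_colour letterColour hv hσ hτ (p := i + 1) (by omega) i.isLt
      (γ i) ih
    simp only [Submodule.mem_comap, map_sum, letterOp_wordVec, hcolour, ite_smul, one_smul,
      zero_smul] at hproj
    rw [← Finset.sum_filter, Finset.filter_filter] at hproj
    simpa only [Finset.forall_mem_insert, and_comm] using hproj

lemma wordVec_permWord_mem (hv : Function.Injective v)
    (hσ : ∀ i, 1 ≤ i → i + 1 ≤ n → K ≤ K.comap (sigmaOp (0 : F) i))
    (hτ : 1 ≤ n → K ≤ K.comap (colourEval letterColour v 1)) (hu : cyclicVector F hm n ∈ K)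
    (g : (Fin n → Fin m) × Equiv.Perm (Fin n)) : wordVec F (permWord hm g) ∈ K := by
  obtain ⟨γ, w⟩ := g
  have hone := wordVec_permWord_one_mem hm hv hσ hτ hu γ
  rcases n with _ | n
  · rwa [Subsingleton.elim w 1]
  have hw : w ∈ Submonoid.closure (Set.range fun i : Fin n => Equiv.swap i.castSucc i.succ) := by
    rw [Equiv.Perm.mclosure_swap_castSucc_succ]
    trivial
  induction hw using Submonoid.closure_induction_right with
  | one => exact hone
  | mul_right w _ y hy ih =>
    obtain ⟨i, rfl⟩ := hy
    have hmem := hσ (i + 1) (by omega) (by omega) ih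
    rwa [Submodule.mem_comap, sigmaOp_zero_wordVec, permWord_exchange] at hmem

end CyclicVector

end ColouredPermutations

section OrbitMap

variable {R F : Type*} [CommRing R] [CommRing F]

lemma span_range_le_span_range_comp {N M ι : Type*} [AddCommGroup N] [Module R N]
    [AddCommGroup M] [Module F M] {φ : R →+* F} (f : N →ₛₗ[φ] M) {b : ι → N}
    (hb : ⊤ ≤ Submodule.span R (Set.range b)) :
    Submodule.span F (Set.range f) ≤ Submodule.span F (Set.range (f ∘ b)) := by
  have hcomap : Submodule.span R (Set.range b) ≤
      (Submodule.span F (Set.range (f ∘ b))).comap f := by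
    rw [Submodule.span_le]
    rintro _ ⟨i, rfl⟩
    exact Submodule.subset_span ⟨i, rfl⟩
  rw [Submodule.span_le]
  rintro _ ⟨x, rfl⟩
  exact hcomap (hb Submodule.mem_top)

variable (φ : R →+* F) {H : Type*} [Ring H] [Algebra R H] {L : Type*}

/-- The orbit map `x ↦ ρ x u` of a vector, followed by a change of the base ring. -/
noncomputable def mapCoeffOrbit (ρ : H →ₐ[R] Module.End R (Word L →₀ R)) (u : Word L →₀ R) :
    H →ₛₗ[φ] (Word L →₀ F) :=
  (mapCoeff φ).comp ((LinearMap.applyₗ u).comp ρ.toLinearMap)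

lemma span_range_mapCoeffOrbit_le_comap {ρ : H →ₐ[R] Module.End R (Word L →₀ R)}
    (u : Word L →₀ R) {x : H} {B : Module.End F (Word L →₀ F)}
    (h : Function.Semiconj (mapCoeff φ) (ρ x) B) :
    Submodule.span F (Set.range (mapCoeffOrbit φ ρ u)) ≤
      (Submodule.span F (Set.range (mapCoeffOrbit φ ρ u))).comap B := by
  rw [Submodule.span_le]
  rintro _ ⟨y, rfl⟩
  refine Submodule.subset_span ⟨x * y, ?_⟩
  change mapCoeff φ (ρ (x * y) u) = B (mapCoeff φ (ρ y u))
  rw [map_mul, Module.End.mul_apply, h]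

end OrbitMap

section Independence

variable {R F ι κ : Type*} [CommRing R] [Field F] (φ : R →+* F)

lemma linearIndependent_of_span_map_eq_top [IsDomain R] [Fintype ι] [Fintype κ]
    (hcard : Fintype.card ι = Fintype.card κ) (A : ι → κ → R)
    (hA : ⊤ ≤ Submodule.span F (Set.range fun i k => φ (A i k))) : LinearIndependent R A := by
  classical
  let e : κ ≃ ι := Fintype.equivOfCardEq hcard.symm
  let B : Matrix κ κ R := Matrix.of fun i k => A (e i) k
  have hF : LinearIndependent F fun i k => φ (A i k) :=
    linearIndependent_of_top_le_span_of_card_eq_finrank hA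
      (hcard.trans (Module.finrank_fintype_fun_eq_card F).symm)
  have hB : IsUnit (φ B.det) := by
    rw [RingHom.map_det, RingHom.mapMatrix_apply, ← Matrix.isUnit_iff_isUnit_det,
      ← Matrix.linearIndependent_rows_iff_isUnit]
    exact hF.comp e e.injective
  refine (linearIndependent_equiv e).1 (Matrix.linearIndependent_rows_of_det_ne_zero (A := B) ?_)
  exact fun hdet => hB.ne_zero (by rw [hdet, map_zero])

lemma linearIndependent_of_wordVec_mem_span [IsDomain R] [Fintype ι] [Fintype κ] {L : Type*}
    {e : κ → Word L} (he : Function.Injective e) (hcard : Fintype.card ι = Fintype.card κ)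
    {y : ι → Word L →₀ R}
    (h : ∀ k, wordVec F (e k) ∈ Submodule.span F (Set.range (mapCoeff φ ∘ y))) :
    LinearIndependent R y := by
  classical
  let restrict : (Word L →₀ F) →ₗ[F] κ → F := LinearMap.funLeft F F e ∘ₗ Finsupp.lcoeFun
  refine LinearIndependent.of_comp (LinearMap.funLeft R R e ∘ₗ Finsupp.lcoeFun) ?_
  refine linearIndependent_of_span_map_eq_top φ hcard _ ?_
  change ⊤ ≤ Submodule.span F (Set.range (restrict ∘ mapCoeff φ ∘ y))
  rw [Set.range_comp restrict, Submodule.span_image, ← (Pi.basisFun F κ).span_eq,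
    Submodule.span_le]
  rintro _ ⟨k, rfl⟩
  refine ⟨wordVec F (e k), h k, ?_⟩
  ext k'
  rw [Pi.basisFun_apply]
  exact Finsupp.single_apply_left he k k' 1

theorem linearIndependent_of_span_eq_top_of_tauOp_of_sigmaOp [IsDomain R] [Fintype ι] {m n : ℕ}
    (hm : 1 ≤ m) {c : R} {v : Fin m → R} (hc : φ c = 0) (hv : Function.Injective (φ ∘ v))
    {H : Type*} [Ring H] [Algebra R H] {t : H} {s : ℕ → H}
    (ρ : H →ₐ[R] Module.End R (Word (Letter m) →₀ R))
    (hρt : 1 ≤ n → ρ t = tauOp c letterColour v (n - 1))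
    (hρs : ∀ i, 1 ≤ i → i + 1 ≤ n → ρ (s i) = sigmaOp c i)
    (hι : Fintype.card ι = n.factorial * m ^ n) {b : ι → H}
    (hb : ⊤ ≤ Submodule.span R (Set.range b)) : LinearIndependent R b := by
  let orbit := mapCoeffOrbit φ ρ (cyclicVector R hm n)
  have hspan (g : (Fin n → Fin m) × Equiv.Perm (Fin n)) :
      wordVec F (permWord hm g) ∈ Submodule.span F (Set.range orbit) := by
    refine wordVec_permWord_mem hm hv (fun i hi hin => ?_) (fun hn => ?_) ?_ g
    · refine span_range_mapCoeffOrbit_le_comap φ _ (x := s i) ?_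
      rw [hρs i hi hin, ← hc]
      exact semiconj_mapCoeff_sigmaOp φ c i
    · refine span_range_mapCoeffOrbit_le_comap φ _ (x := t) ?_
      rw [hρt hn, ← tauOp_zero letterColour _ (n - 1), ← hc]
      exact semiconj_mapCoeff_tauOp φ c letterColour v (n - 1)
    · exact Submodule.subset_span ⟨1, by simp [orbit, mapCoeffOrbit, cyclicVector]⟩
  refine LinearIndependent.of_comp ((LinearMap.applyₗ (cyclicVector R hm n)).comp ρ.toLinearMap)
    (linearIndependent_of_wordVec_mem_span φ (permWord_injective hm) ?_ fun g =>
      span_range_le_span_range_comp orbit hb (hspan g))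
  simp only [hι, Fintype.card_prod, Fintype.card_fun, Fintype.card_perm, Fintype.card_fin,
    mul_comm]

end Independence

/-! ### The cyclotomic Hecke algebra -/

section HeckeSystems

variable {R H : Type*} [CommRing R] [Ring H] [Algebra R H] {m : ℕ} {n : ℕ} {t : H} {s : ℕ → H}

lemma IsHeckeSystem.mono {c : R} {v : Fin m → R} (h : IsHeckeSystem c v n t s) {k : ℕ}
    (hkn : k ≤ n) : IsHeckeSystem c v k t s where
  braid i hi hik := h.braid i hi (hik.trans hkn)
  comm i j hi hij hjk := h.comm i j hi hij (hjk.trans hkn)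
  tau_braid hk := h.tau_braid (hk.trans hkn)
  tau_comm i hi hik := h.tau_comm i hi (hik.trans hkn)
  quadratic i hi hik := h.quadratic i hi (hik.trans hkn)
  cyclotomic hk := h.cyclotomic (hk.trans hkn)

lemma IsHeckeSystem.of_algebraMap {F : Type*} [CommRing F] [Algebra R F] [Algebra F H]
    [IsScalarTower R F H] {c : R} {v : Fin m → R}
    (h : IsHeckeSystem (algebraMap R F c) (fun j => algebraMap R F (v j)) n t s) :
    IsHeckeSystem c v n t s where
  braid := h.braid
  comm := h.comm
  tau_braid := h.tau_braid
  tau_comm := h.tau_comm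
  quadratic i hi hin := by rw [h.quadratic i hi hin, algebraMap_smul]
  cyclotomic hn := by
    simpa only [← IsScalarTower.algebraMap_apply R F H] using h.cyclotomic hn

end HeckeSystems

section Presentation

variable {A : Type} [CommRing A] {m : ℕ} {q : Aˣ} {v : Fin m → A} {n : ℕ}

/-- The assignment of `t` to the generator `τ` and of `s i` to the generator `σ_i`. -/
def genImage {B : Type*} (t : B) (s : ℕ → B) : HeckeGen n → B
  | .tau _ => t
  | .sigma i _ _ => s i

section Lift

variable {B : Type*} [Ring B] [Algebra A B] {t : B} {s : ℕ → B}

lemma IsHeckeSystem.lift_genImage_eq (h : IsHeckeSystem ((q : A) - (q⁻¹ : Aˣ)) v n t s)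
    {x y : FreeAlgebra A (HeckeGen n)} (hxy : Rel q v n x y) :
    FreeAlgebra.lift A (genImage t s) x = FreeAlgebra.lift A (genImage t s) y := by
  have ht : ∀ hn, FreeAlgebra.lift A (genImage t s) (freeTau n hn) = t :=
    fun _ => FreeAlgebra.lift_ι_apply _ _
  have hs : ∀ i hi hin, FreeAlgebra.lift A (genImage t s) (freeSigma n i hi hin) = s i :=
    fun _ _ _ => FreeAlgebra.lift_ι_apply _ _
  cases hxy with
  | braid i hi _ _ hin => simpa only [map_mul, hs] using h.braid i hi hin
  | comm i j hi hin hj hjn hij =>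
    simpa only [map_mul, hs] using (h.commute_s hi hin hj hjn hij).eq
  | tau_braid _ _ hn => simpa only [map_mul, hs, ht] using h.tau_braid hn
  | tau_comm _ i _ hin hi => simpa only [map_mul, hs, ht] using (h.tau_comm i hi hin).eq
  | quadratic i hi hin =>
    simpa only [pow_two, map_mul, map_add, map_smul, map_one, hs] using h.quadratic i hi hin
  | cyclotomic hn =>
    simpa only [map_list_prod, List.map_ofFn, Function.comp_def, map_sub, ht, AlgHom.commutes,
      map_zero] using h.cyclotomic hn

/-- The homomorphism from the Hecke algebra that is determined by elements satisfying the defining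
relations: the universal property of the presentation. -/
def liftHom (h : IsHeckeSystem ((q : A) - (q⁻¹ : Aˣ)) v n t s) : CyclotomicHecke q v n →ₐ[A] B :=
  RingQuot.liftAlgHom A
    ⟨FreeAlgebra.lift A (genImage t s), fun _ _ hxy => h.lift_genImage_eq hxy⟩

lemma liftHom_tau (h : IsHeckeSystem ((q : A) - (q⁻¹ : Aˣ)) v n t s) (hn : 1 ≤ n) :
    liftHom h (tau q v n hn) = t :=
  (RingQuot.liftAlgHom_mkAlgHom_apply A _ _ _).trans (FreeAlgebra.lift_ι_apply _ _)

lemma liftHom_sigma (h : IsHeckeSystem ((q : A) - (q⁻¹ : Aˣ)) v n t s) (i : ℕ) (hi : 1 ≤ i)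
    (hin : i + 1 ≤ n) : liftHom h (sigma q v n i hi hin) = s i :=
  (RingQuot.liftAlgHom_mkAlgHom_apply A _ _ _).trans (FreeAlgebra.lift_ι_apply _ _)

end Lift

section Generators

variable (q v n)

/-- The generator `τ`, with the junk value `0` at level `0`. Together with `genSigma` it puts the
generators into the form required by `IsHeckeSystem`. -/
def genTau : CyclotomicHecke q v n := if h : 1 ≤ n then tau q v n h else 0

/-- The generator `σ_i`, with the junk value `0` when `i` is out of range. -/
def genSigma (i : ℕ) : CyclotomicHecke q v n :=
  if h : 1 ≤ i ∧ i + 1 ≤ n then sigma q v n i h.1 h.2 else 0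

/-- The projection of the free algebra onto its quotient by the defining relations. -/
def mkHom : FreeAlgebra A (HeckeGen n) →ₐ[A] CyclotomicHecke q v n :=
  RingQuot.mkAlgHom A (Rel q v n)

variable {n}

lemma genTau_eq (hn : 1 ≤ n) : genTau q v n = tau q v n hn := dif_pos hn

lemma genSigma_eq {i : ℕ} (hi : 1 ≤ i) (hin : i + 1 ≤ n) :
    genSigma q v n i = sigma q v n i hi hin := dif_pos ⟨hi, hin⟩

lemma mkHom_freeTau (hn : 1 ≤ n) : mkHom q v n (freeTau n hn) = genTau q v n :=
  (genTau_eq q v hn).symm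

lemma mkHom_freeSigma (i : ℕ) (hi : 1 ≤ i) (hin : i + 1 ≤ n) :
    mkHom q v n (freeSigma n i hi hin) = genSigma q v n i :=
  (genSigma_eq q v hi hin).symm

lemma mkHom_eq_of_rel {x y : FreeAlgebra A (HeckeGen n)} (h : Rel q v n x y) :
    mkHom q v n x = mkHom q v n y :=
  RingQuot.mkAlgHom_rel A h

variable (n)

lemma isHeckeSystem_gen :
    IsHeckeSystem ((q : A) - (q⁻¹ : Aˣ)) v n (genTau q v n) (genSigma q v n) where
  braid i hi hin := by
    simpa only [map_mul, mkHom_freeSigma] using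
      mkHom_eq_of_rel q v (.braid i hi (Nat.le_of_succ_le hin) (Nat.le_add_left 1 i) hin)
  comm i j hi hij hjn := by
    simpa only [map_mul, mkHom_freeSigma, commute_iff_eq] using
      mkHom_eq_of_rel q v (.comm i j hi (hij.le.trans (Nat.le_of_succ_le hjn))
        ((Nat.le_add_left 1 i).trans hij.le) hjn (Or.inl hij))
  tau_braid hn := by
    simpa only [map_mul, mkHom_freeTau, mkHom_freeSigma] using
      mkHom_eq_of_rel q v (.tau_braid (Nat.le_of_succ_le hn) le_rfl hn)
  tau_comm i hi hin := by
    simpa only [map_mul, mkHom_freeTau, mkHom_freeSigma, commute_iff_eq] using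
      mkHom_eq_of_rel q v
        (.tau_comm ((Nat.le_add_left 1 i).trans hin) i (Nat.le_of_succ_le hi) hin hi)
  quadratic i hi hin := by
    simpa only [pow_two, map_mul, map_add, map_smul, map_one, mkHom_freeSigma] using
      mkHom_eq_of_rel q v (.quadratic i hi hin)
  cyclotomic hn := by
    simpa only [map_list_prod, List.map_ofFn, Function.comp_def, map_sub, AlgHom.commutes,
      map_zero, mkHom_freeTau] using mkHom_eq_of_rel q v (.cyclotomic hn)

lemma mkHom_mem_parabolic (x : FreeAlgebra A (HeckeGen n)) :
    mkHom q v n x ∈ parabolic A (genTau q v n) (genSigma q v n) n := by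
  induction x using FreeAlgebra.induction with
  | grade0 r => rw [AlgHom.commutes]; exact Subalgebra.algebraMap_mem _ r
  | grade1 g =>
    cases g with
    | tau hn => exact mkHom_freeTau q v hn ▸ t_mem_parabolic hn
    | sigma i hi hin => exact mkHom_freeSigma q v i hi hin ▸ s_mem_parabolic hi hin
  | mul x y hx hy => rw [map_mul]; exact mul_mem hx hy
  | add x y hx hy => rw [map_add]; exact add_mem hx hy

lemma parabolic_gen : parabolic A (genTau q v n) (genSigma q v n) n = ⊤ := by
  refine eq_top_iff.2 fun x _ => ?_
  obtain ⟨y, rfl⟩ : ∃ y, mkHom q v n y = x := RingQuot.mkAlgHom_surjective A (Rel q v n) x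
  exact mkHom_mem_parabolic q v n y

end Generators

section StandardBasis

variable (q v n)

lemma top_le_span_standardMonomial (hm : 1 ≤ m) :
    ⊤ ≤ Submodule.span A (Set.range (standardMonomial (genTau q v n) (genSigma q v n) m n)) := by
  have := (isHeckeSystem_gen q v n).parabolic_le_span_standardMonomial hm le_rfl
  rwa [parabolic_gen, Algebra.top_toSubmodule] at this

variable [IsDomain A] {F : Type*} [Field F] (φ : A →+* F) (hm : 1 ≤ m)
  (hq : φ ((q : A) - (q⁻¹ : Aˣ)) = 0) (hv : Function.Injective (φ ∘ v))

include φ hm hq hv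

theorem linearIndependent_standardMonomial :
    LinearIndependent A (standardMonomial (genTau q v n) (genSigma q v n) m n) :=
  linearIndependent_of_span_eq_top_of_tauOp_of_sigmaOp φ hm hq hv
    (t := genTau q v n) (s := genSigma q v n)
    (liftHom (isHeckeSystem_tauOp_sigmaOp _ v letterColour_mono n))
    (fun hn => by rw [genTau_eq q v hn, liftHom_tau])
    (fun i hi hin => by rw [genSigma_eq q v hi hin, liftHom_sigma])
    (card_monomialIndex m n) (top_le_span_standardMonomial q v n hm)

/-- The Ariki–Koike basis of the Hecke algebra, over a domain with a specialization to a field at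
which `q = q⁻¹` and the parameters `v_1, …, v_m` are pairwise distinct. -/
noncomputable def standardBasis : Module.Basis (MonomialIndex m n) A (CyclotomicHecke q v n) :=
  Module.Basis.mk (linearIndependent_standardMonomial q v n φ hm hq hv)
    (top_le_span_standardMonomial q v n hm)

end StandardBasis

section Inclusion

variable (q v n)

/-- The homomorphism from the Hecke algebra of level `n - 1` to the one of level `n` that preserves
the names of the generators. -/
def inclusionHom : CyclotomicHecke q v (n - 1) →ₐ[A] CyclotomicHecke q v n :=
  liftHom ((isHeckeSystem_gen q v n).mono (Nat.sub_le n 1))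

lemma inclusionHom_tau (hn : 1 ≤ n - 1) :
    inclusionHom q v n (tau q v (n - 1) hn) = tau q v n (by omega) := by
  rw [inclusionHom, liftHom_tau, genTau_eq]

lemma inclusionHom_sigma (i : ℕ) (hi : 1 ≤ i) (hin : i + 1 ≤ n - 1) :
    inclusionHom q v n (sigma q v (n - 1) i hi hin) = sigma q v n i hi (by omega) := by
  rw [inclusionHom, liftHom_sigma, genSigma_eq]

lemma inclusionHom_range : (inclusionHom q v n).range = subW q v n := by
  apply le_antisymm
  · rw [← Algebra.map_top, ← parabolic_gen, parabolic, AlgHom.map_adjoin]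
    refine Algebra.adjoin_mono ?_
    rintro _ ⟨x, ⟨hn, rfl⟩ | ⟨i, hi, hin, rfl⟩, rfl⟩
    · exact Or.inl ⟨by omega, by rw [genTau_eq q v hn, inclusionHom_tau]⟩
    · exact Or.inr ⟨i, hi, by omega, by rw [genSigma_eq q v hi hin, inclusionHom_sigma]⟩
  · refine Algebra.adjoin_le ?_
    rintro x (⟨hn, rfl⟩ | ⟨i, hi, hin, rfl⟩)
    · exact ⟨_, inclusionHom_tau q v n (by omega)⟩
    · exact ⟨_, inclusionHom_sigma q v n i hi (by omega)⟩

lemma inclusionHom_standardMonomial (i : MonomialIndex m n) :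
    inclusionHom q v (n + 1) (standardMonomial (genTau q v n) (genSigma q v n) m n i) =
      standardMonomial (genTau q v (n + 1)) (genSigma q v (n + 1)) m n i :=
  map_standardMonomial (f := (inclusionHom q v (n + 1)).toRingHom)
    (fun hn => by
      rw [genTau_eq q v hn, genTau_eq q v (Nat.le_succ_of_le hn)]
      exact inclusionHom_tau q v (n + 1) hn)
    (fun i hi hin => by
      rw [genSigma_eq q v hi hin, genSigma_eq q v hi (Nat.le_succ_of_le hin)]
      exact inclusionHom_sigma q v (n + 1) i hi hin) i

lemma standardMonomial_succ_zero_zero {H : Type*} [Ring H] (t : H) (s : ℕ → H) (hm : 0 < m)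
    (i : MonomialIndex m n) :
    standardMonomial t s m (n + 1) (i, ⟨0, hm⟩, 0) = standardMonomial t s m n i := by
  simp [standardMonomial, descending]

variable [IsDomain A] {F : Type*} [Field F] (φ : A →+* F) (hm : 1 ≤ m)
  (hq : φ ((q : A) - (q⁻¹ : Aˣ)) = 0) (hv : Function.Injective (φ ∘ v))

include φ hm hq hv

lemma linearIndependent_standardMonomial_succ : LinearIndependent A
    (standardMonomial (genTau q v (n + 1)) (genSigma q v (n + 1)) m n) := by
  have hinj : Function.Injective
      fun i : MonomialIndex m n => ((i, ⟨0, hm⟩, 0) : MonomialIndex m (n + 1)) :=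
    fun _ _ h => congrArg Prod.fst h
  convert (linearIndependent_standardMonomial q v (n + 1) φ hm hq hv).comp _ hinj using 1
  exact funext fun i => (standardMonomial_succ_zero_zero n _ _ hm i).symm

lemma inclusionHom_succ_injective : Function.Injective (inclusionHom q v (n + 1)) := by
  have himage : (inclusionHom q v (n + 1)).toLinearMap ∘
      standardMonomial (genTau q v n) (genSigma q v n) m n =
        standardMonomial (genTau q v (n + 1)) (genSigma q v (n + 1)) m n :=
    funext (inclusionHom_standardMonomial q v n)
  refine LinearMap.injective_of_linearIndependent (f := (inclusionHom q v (n + 1)).toLinearMap)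
    (top_le_iff.1 (top_le_span_standardMonomial q v n hm)) ?_
  exact himage ▸ linearIndependent_standardMonomial_succ q v n φ hm hq hv

end Inclusion

end Presentation

end CyclotomicHecke

namespace reflectionGroup

/-! ### The reflection group -/

section Monomial

variable {m n : ℕ}

/-- The monomial matrix with entry `z i` in row `i` and with nonzero positions `(π j, j)`. -/
def monomialMatrix (z : Fin n → rootsOfUnity m ℂ) (π : Equiv.Perm (Fin n)) :
    Matrix (Fin n) (Fin n) ℂ :=
  Matrix.of fun i j => if i = π j then ((z i : ℂˣ) : ℂ) else 0

lemma monomialMatrix_mul (z w : Fin n → rootsOfUnity m ℂ) (π ρ : Equiv.Perm (Fin n)) :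
    monomialMatrix z π * monomialMatrix w ρ =
      monomialMatrix (fun i => z i * w (π⁻¹ i)) (π * ρ) := by
  ext i j
  rw [Matrix.mul_apply, Finset.sum_eq_single (ρ j)]
  · simp only [monomialMatrix, Matrix.of_apply]
    by_cases hi : i = π (ρ j)
    · subst hi
      simp
    · simp [hi]
  · intro k _ hk
    simp [monomialMatrix, hk]
  · simp

lemma monomialMatrix_one : monomialMatrix (1 : Fin n → rootsOfUnity m ℂ) 1 = 1 := by
  ext i j
  obtain rfl | h := eq_or_ne i j
  · simp [monomialMatrix]
  · simp [monomialMatrix, h]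

/-- The element of the reflection group with the given monomial matrix. -/
def monomial (z : Fin n → rootsOfUnity m ℂ) (π : Equiv.Perm (Fin n)) : reflectionGroup m n :=
  ⟨⟨monomialMatrix z π, monomialMatrix (fun i => (z (π i))⁻¹) π⁻¹,
    by simpa [monomialMatrix_mul, Pi.one_def] using monomialMatrix_one,
    by simpa [monomialMatrix_mul, Pi.one_def] using monomialMatrix_one⟩,
    z, π, fun _ _ => rfl⟩

lemma monomial_apply (z : Fin n → rootsOfUnity m ℂ) (π : Equiv.Perm (Fin n)) (i j : Fin n) :
    (monomial z π : GL (Fin n) ℂ) i j = if i = π j then ((z i : ℂˣ) : ℂ) else 0 :=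
  rfl

lemma monomial_mul (z w : Fin n → rootsOfUnity m ℂ) (π ρ : Equiv.Perm (Fin n)) :
    monomial z π * monomial w ρ = monomial (fun i => z i * w (π⁻¹ i)) (π * ρ) :=
  Subtype.ext (Units.ext (monomialMatrix_mul z w π ρ))

lemma monomial_one : monomial (1 : Fin n → rootsOfUnity m ℂ) 1 = 1 :=
  Subtype.ext (Units.ext monomialMatrix_one)

lemma monomial_injective : Function.Injective
    fun p : (Fin n → rootsOfUnity m ℂ) × Equiv.Perm (Fin n) => monomial p.1 p.2 := by
  rintro ⟨z, π⟩ ⟨w, ρ⟩ h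
  have hentry : ∀ i j, (if i = π j then ((z i : ℂˣ) : ℂ) else 0) =
      if i = ρ j then ((w i : ℂˣ) : ℂ) else 0 := fun i j => by
    rw [← monomial_apply, ← monomial_apply]
    exact congrArg (fun g : reflectionGroup m n => (g : GL (Fin n) ℂ) i j) h
  obtain rfl : π = ρ := by
    ext1 j
    by_contra hne
    simpa [hne] using hentry (π j) j
  refine Prod.ext (funext fun i => ?_) rfl
  exact Subtype.ext (Units.ext (by simpa using hentry i (π.symm i)))

lemma exists_eq_monomial (g : reflectionGroup m n) : ∃ z π, g = monomial z π := by
  obtain ⟨g, z, π, hg⟩ := g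
  exact ⟨z, π, Subtype.ext (Units.ext (Matrix.ext hg))⟩

lemma monomial_bijective : Function.Bijective
    fun p : (Fin n → rootsOfUnity m ℂ) × Equiv.Perm (Fin n) => monomial p.1 p.2 :=
  ⟨monomial_injective, fun g => let ⟨z, π, h⟩ := exists_eq_monomial g; ⟨(z, π), h.symm⟩⟩

lemma natCard (hm : 1 ≤ m) : Nat.card (reflectionGroup m n) = n.factorial * m ^ n := by
  have : NeZero m := ⟨by omega⟩
  rw [← Nat.card_congr (.ofBijective _ (monomial_bijective (m := m) (n := n))), Nat.card_prod,
    Nat.card_fun, Complex.card_rootsOfUnity, Nat.card_perm, Nat.card_fin, mul_comm]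

lemma finite (hm : 1 ≤ m) : Finite (reflectionGroup m n) :=
  Nat.finite_of_card_ne_zero <| natCard hm ▸
    Nat.mul_ne_zero n.factorial_ne_zero (pow_ne_zero _ (by omega))

/-- The embedding of the diagonal matrices. -/
def diagonal : (Fin n → rootsOfUnity m ℂ) →* reflectionGroup m n where
  toFun z := monomial z 1
  map_one' := monomial_one
  map_mul' z w := by simp [monomial_mul, Pi.mul_def]

/-- The embedding of the symmetric group as the permutation matrices. -/
def permutation : Equiv.Perm (Fin n) →* reflectionGroup m n where
  toFun π := monomial 1 π
  map_one' := monomial_one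
  map_mul' π ρ := by simp [monomial_mul, Pi.one_def]

lemma diagonal_mul_permutation (z : Fin n → rootsOfUnity m ℂ) (π : Equiv.Perm (Fin n)) :
    diagonal z * permutation π = monomial z π := by
  simp [diagonal, permutation, monomial_mul]

lemma permutation_mul_diagonal (z : Fin n → rootsOfUnity m ℂ) (π : Equiv.Perm (Fin n)) :
    permutation π * diagonal z = diagonal (fun i => z (π⁻¹ i)) * permutation π := by
  rw [diagonal_mul_permutation]
  simp [diagonal, permutation, monomial_mul]

end Monomial

section Generators

variable {m n : ℕ}

/-- The homomorphism `ζ ↦ diag(ζ, 1, …, 1)`, which is trivial if `n = 0`. It sends a primitive root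
of unity to the image of `τ`. -/
def firstReflection : rootsOfUnity m ℂ →* reflectionGroup m n where
  toFun ζ := diagonal fun i => if (i : ℕ) = 0 then ζ else 1
  map_one' := by simp only [ite_self]; exact map_one diagonal
  map_mul' ζ ξ := by
    rw [← map_mul]
    congr 1
    funext i
    simp only [Pi.mul_apply]
    split_ifs <;> simp

lemma firstReflection_apply (ζ : rootsOfUnity m ℂ) :
    firstReflection (n := n) ζ = diagonal fun i => if (i : ℕ) = 0 then ζ else 1 :=
  rfl

lemma firstReflection_zero (ζ : rootsOfUnity m ℂ) : firstReflection (n := 0) ζ = 1 :=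
  (congrArg diagonal (Subsingleton.elim _ 1)).trans (map_one diagonal)

lemma firstReflection_eq_diagonal_mulSingle (ζ : rootsOfUnity m ℂ) :
    firstReflection (n := n + 1) ζ = diagonal (Pi.mulSingle 0 ζ) := by
  rw [firstReflection_apply]
  congr 1
  funext i
  simp only [Pi.mulSingle_apply, Fin.ext_iff, Fin.val_zero]

variable (n) in
/-- The transposition of `i - 1` and `i`, or `1` if `n ≤ i`. Positions are counted from `0`, so this
is the image of `σ_i`. -/
def adjacentSwap (i : ℕ) : Equiv.Perm (Fin n) :=
  if h : i < n then Equiv.swap ⟨i - 1, by omega⟩ ⟨i, h⟩ else 1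

lemma adjacentSwap_eq {i : ℕ} (h : i < n) :
    adjacentSwap n i = Equiv.swap ⟨i - 1, by omega⟩ ⟨i, h⟩ := dif_pos h

lemma adjacentSwap_apply {i : ℕ} (h : i < n) (j : Fin n) :
    (adjacentSwap n i j : ℕ) = if (j : ℕ) = i - 1 then i else if (j : ℕ) = i then i - 1 else j := by
  rw [adjacentSwap_eq h, Equiv.swap_apply_def]
  simp only [Fin.ext_iff]
  split_ifs <;> rfl

lemma adjacentSwap_mul_self (i : ℕ) : adjacentSwap n i * adjacentSwap n i = 1 := by
  rw [adjacentSwap]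
  split_ifs <;> simp

lemma adjacentSwap_inv (i : ℕ) : (adjacentSwap n i)⁻¹ = adjacentSwap n i :=
  inv_eq_of_mul_eq_one_left (adjacentSwap_mul_self i)

lemma adjacentSwap_braid {i : ℕ} (hi : 1 ≤ i) (hin : i + 1 < n) :
    adjacentSwap n i * adjacentSwap n (i + 1) * adjacentSwap n i =
      adjacentSwap n (i + 1) * adjacentSwap n i * adjacentSwap n (i + 1) := by
  ext x
  simp only [Equiv.Perm.mul_apply, adjacentSwap_apply hin,
    adjacentSwap_apply (i.lt_succ_self.trans hin), Nat.add_sub_cancel]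
  grind

lemma commute_adjacentSwap {i j : ℕ} (hij : i + 1 < j) (hjn : j < n) :
    Commute (adjacentSwap n i) (adjacentSwap n j) := by
  ext x
  simp only [Equiv.Perm.mul_apply, adjacentSwap_apply hjn,
    adjacentSwap_apply (show i < n by omega)]
  grind

lemma commute_firstReflection_permutation_adjacentSwap (ζ : rootsOfUnity m ℂ) {i : ℕ}
    (hi : 2 ≤ i) (hin : i < n) :
    Commute (firstReflection (n := n) ζ) (permutation (adjacentSwap n i)) := by
  rw [Commute, SemiconjBy, firstReflection_apply, permutation_mul_diagonal, adjacentSwap_inv]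
  congr 2
  funext j
  rw [adjacentSwap_apply hin]
  grind

lemma permutation_mul_firstReflection_mul_permutation (ζ : rootsOfUnity m ℂ) (hn : 2 ≤ n) :
    permutation (adjacentSwap n 1) * firstReflection ζ * permutation (adjacentSwap n 1) =
      diagonal fun i => if (i : ℕ) = 1 then ζ else 1 := by
  rw [firstReflection_apply, permutation_mul_diagonal, mul_assoc, ← map_mul,
    adjacentSwap_mul_self, map_one, mul_one, adjacentSwap_inv]
  congr 1
  funext j
  rw [adjacentSwap_apply hn]
  grind

lemma firstReflection_braid (ζ : rootsOfUnity m ℂ) (hn : 2 ≤ n) :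
    firstReflection ζ * permutation (adjacentSwap n 1) * firstReflection ζ *
        permutation (adjacentSwap n 1) =
      permutation (adjacentSwap n 1) * firstReflection ζ * permutation (adjacentSwap n 1) *
        firstReflection ζ := by
  rw [mul_assoc, mul_assoc, ← mul_assoc (permutation _) (firstReflection ζ),
    permutation_mul_firstReflection_mul_permutation ζ hn, firstReflection_apply, ← map_mul,
    ← map_mul, mul_comm]

end Generators

section Generation

variable {m n : ℕ} {Γ : Submonoid (reflectionGroup m n)}

lemma permutation_mem (hs : ∀ i, 1 ≤ i → i < n → permutation (adjacentSwap n i) ∈ Γ)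
    (π : Equiv.Perm (Fin n)) : permutation π ∈ Γ := by
  cases n with
  | zero => rw [Subsingleton.elim π 1, map_one]; exact one_mem Γ
  | succ n =>
    have hle : Submonoid.closure (Set.range fun i : Fin n => Equiv.swap i.castSucc i.succ) ≤
        Γ.comap permutation := by
      rw [Submonoid.closure_le]
      rintro _ ⟨i, rfl⟩
      have := hs (i + 1) (by omega) (by omega)
      rwa [adjacentSwap_eq (by omega)] at this
    rw [Equiv.Perm.mclosure_swap_castSucc_succ] at hle
    exact hle (Submonoid.mem_top π)

lemma diagonal_mulSingle_eq (i : Fin (n + 1)) (ζ : rootsOfUnity m ℂ) :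
    diagonal (Pi.mulSingle i ζ) =
      permutation (Equiv.swap 0 i) * firstReflection ζ * permutation (Equiv.swap 0 i) := by
  rw [firstReflection_eq_diagonal_mulSingle, permutation_mul_diagonal, mul_assoc, ← map_mul,
    Equiv.swap_mul_self, map_one, mul_one]
  congr 1
  funext j
  simp only [Pi.mulSingle_apply, Equiv.swap_inv, Equiv.swap_apply_eq_iff, Equiv.swap_apply_left]

lemma diagonal_mem (ht : ∀ ζ, firstReflection ζ ∈ Γ) (hperm : ∀ π, permutation π ∈ Γ)
    (z : Fin n → rootsOfUnity m ℂ) : diagonal z ∈ Γ := by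
  cases n with
  | zero => rw [Subsingleton.elim z 1, map_one]; exact one_mem Γ
  | succ n =>
    change z ∈ Γ.comap diagonal
    rw [← Finset.univ_prod_mulSingle z]
    refine Submonoid.prod_mem _ fun i _ => ?_
    rw [Submonoid.mem_comap, diagonal_mulSingle_eq]
    exact mul_mem (mul_mem (hperm _) (ht _)) (hperm _)

variable [NeZero m] {ζ : rootsOfUnity m ℂ} (hζ : IsPrimitiveRoot (ζ : ℂˣ) m)

include hζ

lemma firstReflection_mem (ht : firstReflection ζ ∈ Γ) (ξ : rootsOfUnity m ℂ) :
    firstReflection ξ ∈ Γ := by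
  obtain ⟨k, _, hk⟩ := hζ.eq_pow_of_mem_rootsOfUnity ξ.2
  rw [show ξ = ζ ^ k from Subtype.ext hk.symm, map_pow]
  exact pow_mem ht k

theorem eq_top_of_firstReflection_mem_of_permutation_mem (ht : 1 ≤ n → firstReflection ζ ∈ Γ)
    (hs : ∀ i, 1 ≤ i → i < n → permutation (adjacentSwap n i) ∈ Γ) : Γ = ⊤ := by
  refine eq_top_iff.2 fun g _ => ?_
  obtain ⟨z, π, rfl⟩ := exists_eq_monomial g
  rw [← diagonal_mul_permutation]
  refine mul_mem (diagonal_mem (firstReflection_mem hζ ?_) (permutation_mem hs) z)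
    (permutation_mem hs π)
  rcases Nat.eq_zero_or_pos n with rfl | hn
  · rw [firstReflection_zero]
    exact one_mem Γ
  · exact ht hn

end Generation

section GroupAlgebra

open CyclotomicHecke MonoidAlgebra

variable {m : ℕ} {ζ : rootsOfUnity m ℂ} (hζ : IsPrimitiveRoot (ζ : ℂˣ) m) (n : ℕ)

include hζ

theorem isHeckeSystem_groupAlgebra (hm : 1 ≤ m) :
    IsHeckeSystem (0 : ℂ) (fun j : Fin m => ((ζ : ℂˣ) : ℂ) ^ (j : ℕ)) n
      (of ℂ (reflectionGroup m n) (firstReflection ζ))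
      (fun i => of ℂ (reflectionGroup m n) (permutation (adjacentSwap n i))) where
  braid i hi hin := by
    simp only [← map_mul]
    rw [adjacentSwap_braid hi hin]
  comm i j _ hij hjn := ((commute_adjacentSwap hij hjn).map permutation).map (of ℂ _)
  tau_braid hn := by
    simp only [← map_mul]
    rw [firstReflection_braid ζ hn]
  tau_comm i hi hin :=
    (commute_firstReflection_permutation_adjacentSwap ζ hi hin).map (of ℂ _)
  quadratic i _ _ := by
    rw [← map_mul, ← map_mul, adjacentSwap_mul_self, map_one, map_one, zero_smul, zero_add]
  cyclotomic _ := by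
    have hprod : ∏ j : Fin m, (Polynomial.X - Polynomial.C (((ζ : ℂˣ) : ℂ) ^ (j : ℕ))) =
        Polynomial.X ^ m - 1 := by
      have hζ' : IsPrimitiveRoot ((ζ : ℂˣ) : ℂ) m := IsPrimitiveRoot.coe_units_iff.2 hζ
      rw [Fin.prod_univ_eq_prod_range fun j => Polynomial.X - Polynomial.C (((ζ : ℂˣ) : ℂ) ^ j),
        ← map_one Polynomial.C, X_pow_sub_C_eq_prod hζ' hm (one_pow m)]
      simp only [mul_one]
    have hpow : ζ ^ m = 1 := Subtype.ext ζ.2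
    rw [prod_ofFn_sub_algebraMap, hprod, map_sub, map_pow, Polynomial.aeval_X, ← map_pow,
      ← map_pow, hpow, map_one, map_one, map_one, sub_self]

theorem subalgebra_eq_top [NeZero m] {B : Subalgebra ℂ (MonoidAlgebra ℂ (reflectionGroup m n))}
    (ht : 1 ≤ n → of ℂ (reflectionGroup m n) (firstReflection ζ) ∈ B)
    (hs : ∀ i, 1 ≤ i → i < n →
      of ℂ (reflectionGroup m n) (permutation (adjacentSwap n i)) ∈ B) : B = ⊤ := by
  have hΓ : B.toSubmonoid.comap (of ℂ (reflectionGroup m n)) = ⊤ :=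
    eq_top_of_firstReflection_mem_of_permutation_mem hζ ht hs
  have hof (g : reflectionGroup m n) : of ℂ _ g ∈ B :=
    Submonoid.mem_comap.1 (hΓ ▸ Submonoid.mem_top g)
  refine eq_top_iff.2 fun x _ => ?_
  induction x using MonoidAlgebra.induction_on with
  | of g => exact hof g
  | add x y hx hy => exact add_mem (hx trivial) (hy trivial)
  | smul r x hx => exact B.smul_mem (hx trivial) r

end GroupAlgebra

end reflectionGroup

namespace CyclotomicHecke

/-! ### The generic algebra -/

section Generic

variable {m : ℕ}

lemma specialization_X (j : Fin m) : specialization m (MvPolynomial.X j) =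
    Complex.exp (2 * Real.pi * Complex.I / m) ^ (j : ℕ) :=
  MvPolynomial.eval₂Hom_X' _ _ _

variable (m) in
lemma specialization_genericQ :
    specialization m ((genericQ m : GenericRing m) - ((genericQ m)⁻¹ : (GenericRing m)ˣ)) = 0 := by
  have hq : Units.map (specialization m : GenericRing m →* ℂ) (genericQ m) = 1 := by
    ext
    change specialization m (MvPolynomial.C (LaurentPolynomial.T 1)) = 1
    rw [specialization, MvPolynomial.eval₂Hom_C, LaurentPolynomial.eval₂_T]
    simp
  have hinv := congrArg Units.val (congrArg (·⁻¹) hq)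
  rw [map_sub, sub_eq_zero]
  exact (congrArg Units.val hq).trans (by simpa using hinv.symm)

lemma specialization_X_injective (hm : 1 ≤ m) :
    Function.Injective (specialization m ∘ (MvPolynomial.X : Fin m → GenericRing m)) := by
  intro i j hij
  simp only [Function.comp_apply, specialization_X] at hij
  exact Fin.ext ((Complex.isPrimitiveRoot_exp m (by omega)).pow_inj i.2 j.2 hij)

/-- The Ariki–Koike basis of the generic algebra. -/
noncomputable def genericBasis (hm : 1 ≤ m) (n : ℕ) :
    Module.Basis (MonomialIndex m n) (GenericRing m) (Generic m n) :=
  standardBasis (genericQ m) MvPolynomial.X n (specialization m) hm (specialization_genericQ m)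
    (specialization_X_injective hm)

lemma finrank_generic (hm : 1 ≤ m) (n : ℕ) :
    Module.finrank (GenericRing m) (Generic m n) = n.factorial * m ^ n := by
  rw [Module.finrank_eq_card_basis (genericBasis hm n), card_monomialIndex]

end Generic

section Specialization

open reflectionGroup

attribute [local instance] specializationAlgebra

/-- The root of unity `exp (2πi / m)` at whose powers the parameters are specialized. -/
noncomputable def rootZeta (m : ℕ) [NeZero m] : rootsOfUnity m ℂ :=
  (Complex.isPrimitiveRoot_exp m (NeZero.ne m)).toRootsOfUnity

variable (m : ℕ) [NeZero m] (n : ℕ)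

lemma isPrimitiveRoot_rootZeta : IsPrimitiveRoot (rootZeta m : ℂˣ) m :=
  IsPrimitiveRoot.coe_units_iff.1 (Complex.isPrimitiveRoot_exp m (NeZero.ne m))

lemma isHeckeSystem_generic_groupAlgebra :
    IsHeckeSystem ((genericQ m : GenericRing m) - ((genericQ m)⁻¹ : (GenericRing m)ˣ))
      (MvPolynomial.X : Fin m → GenericRing m) n
      (MonoidAlgebra.of ℂ (reflectionGroup m n) (firstReflection (rootZeta m)))
      (fun i => MonoidAlgebra.of ℂ (reflectionGroup m n) (permutation (adjacentSwap n i))) := by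
  refine IsHeckeSystem.of_algebraMap (F := ℂ) ?_
  have hq : algebraMap (GenericRing m) ℂ
      ((genericQ m : GenericRing m) - ((genericQ m)⁻¹ : (GenericRing m)ˣ)) = 0 :=
    specialization_genericQ m
  have hX : (fun j : Fin m => algebraMap (GenericRing m) ℂ (MvPolynomial.X j)) =
      fun j : Fin m => ((rootZeta m : ℂˣ) : ℂ) ^ (j : ℕ) :=
    funext specialization_X
  rw [hq, hX]
  exact reflectionGroup.isHeckeSystem_groupAlgebra (isPrimitiveRoot_rootZeta m) n (NeZero.one_le)

/-- The homomorphism from the specialized generic algebra to the group algebra that sends `τ` to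
`diag(ζ, 1, …, 1)` and `σ_i` to an adjacent transposition. -/
noncomputable def specializationHom :
    ℂ ⊗[GenericRing m] Generic m n →ₐ[ℂ] MonoidAlgebra ℂ (reflectionGroup m n) :=
  Algebra.TensorProduct.lift (Algebra.ofId ℂ _) (liftHom (isHeckeSystem_generic_groupAlgebra m n))
    fun r _ => Algebra.commutes r _

lemma specializationHom_one_tmul (x : Generic m n) :
    specializationHom m n (1 ⊗ₜ x) = liftHom (isHeckeSystem_generic_groupAlgebra m n) x :=
  (Algebra.TensorProduct.lift_tmul _ _ _ _ _).trans (by rw [map_one, one_mul])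

lemma specializationHom_surjective : Function.Surjective (specializationHom m n) := by
  rw [← AlgHom.range_eq_top]
  refine subalgebra_eq_top (isPrimitiveRoot_rootZeta m) n (fun hn => ?_) fun i hi hin => ?_
  · exact ⟨1 ⊗ₜ tau _ _ n hn, (specializationHom_one_tmul m n _).trans (liftHom_tau _ hn)⟩
  · exact ⟨1 ⊗ₜ sigma _ _ n i hi hin, 
      (specializationHom_one_tmul m n _).trans (liftHom_sigma _ i hi hin)⟩

lemma finrank_specialization :
    Module.finrank ℂ (ℂ ⊗[GenericRing m] Generic m n) =
      Module.finrank ℂ (MonoidAlgebra ℂ (reflectionGroup m n)) := by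
  have hm : 1 ≤ m := NeZero.one_le
  have := Module.Free.of_basis (genericBasis hm n)
  have := Module.Finite.of_basis (genericBasis hm n)
  rw [Module.finrank_baseChange, finrank_generic hm,
    Module.finrank_eq_nat_card_basis (MonoidAlgebra.basis (reflectionGroup m n) ℂ), natCard hm]

lemma specializationHom_bijective : Function.Bijective (specializationHom m n) := by
  have hm : 1 ≤ m := NeZero.one_le
  have := Module.Finite.of_basis (genericBasis hm n)
  have := reflectionGroup.finite (n := n) hm
  have := Module.Finite.of_basis (MonoidAlgebra.basis (reflectionGroup m n) ℂ)
  have hsurj := specializationHom_surjective m n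
  exact ⟨(LinearMap.injective_iff_surjective_of_finrank_eq_finrank
    (f := (specializationHom m n).toLinearMap) (finrank_specialization m n)).2 hsurj, hsurj⟩

/-- The specialization at `q = 1`, `v_j = ζ^(j-1)` as a group algebra. -/
noncomputable def specializationEquiv :
    ℂ ⊗[GenericRing m] Generic m n ≃ₐ[ℂ] MonoidAlgebra ℂ (reflectionGroup m n) :=
  .ofBijective (specializationHom m n) (specializationHom_bijective m n)

end Specialization

theorem exists_algEquiv_subW {m n : ℕ} (hm : 1 ≤ m) (hn : 1 ≤ n) :
    ∃ e : Generic m (n - 1) ≃ₐ[GenericRing m]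
        subW (genericQ m) (MvPolynomial.X : Fin m → GenericRing m) n,
      (∀ h : 1 ≤ n - 1,
        (e (tau _ _ (n - 1) h) : Generic m n) = tau _ _ n (by omega)) ∧
      ∀ (i : ℕ) (h₁ : 1 ≤ i) (h₂ : i + 1 ≤ n - 1),
        (e (sigma _ _ (n - 1) i h₁ h₂) : Generic m n) = sigma _ _ n i h₁ (by omega) := by
  obtain ⟨n, rfl⟩ : ∃ k, n = k + 1 := ⟨n - 1, by omega⟩
  have hinj := inclusionHom_succ_injective (genericQ m) MvPolynomial.X n (specialization m) hm
    (specialization_genericQ m) (specialization_X_injective hm)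
  exact ⟨(AlgEquiv.ofInjective _ hinj).trans
      (Subalgebra.equivOfEq _ _ (inclusionHom_range _ _ (n + 1))),
    inclusionHom_tau _ _ (n + 1), inclusionHom_sigma _ _ (n + 1)⟩

end CyclotomicHecke

open CyclotomicHecke in
theorem mainTheorem2 (m n : ℕ) (hm : 1 ≤ m) :
    -- (i) freeness over `ℂ[q, q⁻¹, v_1, …, v_m]` and the rank
    (Module.Free (GenericRing m) (Generic m n) ∧
      Module.Finite (GenericRing m) (Generic m n) ∧
      Module.finrank (GenericRing m) (Generic m n) = Nat.card (reflectionGroup m n) ∧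
      Nat.card (reflectionGroup m n) = n.factorial * m ^ n) ∧
    -- (i) the specialization at `q = 1`, `v_j = ζ^{j-1}` is the group algebra of `G(m,1,n)`
    (letI : Algebra (GenericRing m) ℂ := specializationAlgebra m
     Nonempty (ℂ ⊗[GenericRing m] Generic m n ≃ₐ[ℂ] MonoidAlgebra ℂ (reflectionGroup m n))) ∧
    -- (ii) `H(m,1,n-1)` is isomorphic to the subalgebra `W̃`, generators going to generators
    (1 ≤ n →
      ∃ e : Generic m (n - 1) ≃ₐ[GenericRing m]
          subW (genericQ m) (MvPolynomial.X : Fin m → GenericRing m) n,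
        (∀ h : 1 ≤ n - 1,
          (e (tau _ _ (n - 1) h) : Generic m n) = tau _ _ n (by omega)) ∧
        ∀ (i : ℕ) (h₁ : 1 ≤ i) (h₂ : i + 1 ≤ n - 1),
          (e (sigma _ _ (n - 1) i h₁ h₂) : Generic m n) = sigma _ _ n i h₁ (by omega)) := by
  have : NeZero m := ⟨by omega⟩
  exact ⟨⟨.of_basis (genericBasis hm n), .of_basis (genericBasis hm n),
      (finrank_generic hm n).trans (reflectionGroup.natCard hm).symm, reflectionGroup.natCard hm⟩,
    ⟨specializationEquiv m n⟩, exists_algEquiv_subW hm⟩
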